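/- **Notation.** $S_\infty$ is the group of permutations of $\omega$. A subgroup of $S_\infty$ is *cofinitary* if each of its elements other than the identity has only finitely many fixed points. Let $\mathcal G\le S_\infty$ be a cofinitary group. Elements of the free product $\mathcal G*\mathbb F(X)$ are written as reduced words in the letters $g\in\mathcal G\setminus\{1\}$ and $X,X^{-1}$ (no two adjacent letters from $\mathcal G$, no $X$ adjacent to $X^{-1}$). For a partial injection $s$ of $\omega$, $w[s]$ is the partial injection obtained by replacing $X$ by $s$ and composing (the right-most letter acts first), and $\operatorname{fix}(f)=\{n: f(n)=n\}$. A word $w$ *has a proper conjugated subword* if, letter by letter, $w=v^{-1}uv$ for some nonempty $v$. Let $\mathcal G'$ be the set of words $w$ in which $X$ or $X^{-1}$ occurs, which have no proper conjugated subword, and which are not of the form $v^n$ with $n\ge 2$ in $\mathcal G*\mathbb F(X)$. Let $\bar z:\mathcal G'\to{}^\omega2$. For $\chi\in 2^{\le\omega}$ and $w\in\mathcal G'$, $(w,s)$ *codes* $\chi$ *with parameter* $m$ if for all $k<\operatorname{lh}(\chi)$, $w^{3k}[s](m)$ is defined and $w^{3k}[s](m)\equiv\chi(k)\pmod 2$.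 If $\operatorname{lh}(\chi)=k+1<\omega$, it *exactly codes* $\chi$ with parameter $m$ if moreover $(X^{i}g\,w^{3k})[s](m)$ is undefined, where $X^i$ ($i=\pm1$) is the right-most occurrence of $X^{\pm1}$ in $w$ and $g\in\mathcal G$ is the (possibly trivial) part of $w$ to the right of it. (The empty sequence is never exactly coded.) The forcing $\mathbb Q^{\bar z}_{\mathcal G}$ consists of the triples $p=(s^p,F^p,\bar m^p)$ where $s^p$ is a finite partial injection of $\omega$, $F^p$ is a finite set of words without proper conjugated subwords, and $\bar m^p$ is a finite partial function from $\mathcal G'$ to $\omega$ such that for each $w\in\operatorname{dom}(\bar m^p)$ there is $l\in\omega$ such that $(w,s^p)$ exactly codes $\bar z(w)\restriction l$ with parameter $\bar m^p(w)$. We put $q\le p$ if $s^q\supseteq s^p$, $F^q\supseteq F^p$, $\bar m^q\supseteq\bar m^p$ and $\operatorname{fix}(w[s^q])=\operatorname{fix}(w[s^p])$ for all $w\in F^p\setminus\mathcal G$. **Theorem.** Let the ground model $M$ be a transitive model of ZFC with $\mathcal G,\bar z\in M$. Suppose that $\mathcal G$ is a cofinitary group such that for each $n\in\omega$, all $i_0,\dots,i_n\in\{0,1\}$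 and all pairwise distinct $g_0,\dots,g_n\in\mathcal G$ there are infinitely many $m$ such that $g_j(m)\equiv i_j\pmod 2$ for each $j\le n$. Let $G$ be a $\mathbb Q^{\bar z}_{\mathcal G}$-generic filter over $M$. Then $\sigma^G=\bigcup\{s^p: p\in G\}$ is a permutation of $\omega$, and 1. the group $\langle\mathcal G\cup\{\sigma^G\}\rangle$ is cofinitary; 2. if $\tau\in M$ is a permutation of $\omega$, $\tau\notin\mathcal G$, and $\langle\{\tau\}\cup\mathcal G\rangle$ is cofinitary, then there are infinitely many $n$ such that $\tau(n)=\sigma^G(n)$, and $\langle\mathcal G\cup\{\sigma^G\}\cup\{\tau\}\rangle$ is not cofinitary; 3. for each $w\in\mathcal G'$ there is $m\in\omega$ such that $(w,\sigma^G)$ codes $\bar z(w)$ with parameter $m$, i.e. $w^{3k}[\sigma^G](m)\equiv\bar z(w)(k)\pmod 2$ for all $k\in\omega$. -/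

import Mathlib

universe u

namespace ZhangCoding

/-! ## Transitive models of ZFC inside the universe of sets -/

/-- The only symbol of the language of set theory: a binary relation. -/
inductive MemRel : ℕ → Type
  | mem : MemRel 2

/-- The first-order language of set theory. -/
def setLang : FirstOrder.Language := ⟨fun _ => Empty, MemRel⟩

/-- A class of sets, with the true membership relation, as a structure for set theory. -/
instance setStructure (M : Set ZFSet.{u}) : setLang.Structure M where
  funMap f := f.elim
  RelMap {_} r := match r with
    | MemRel.mem => fun v => (v 0).1 ∈ (v 1).1

/-- `M` is transitive and `(M, ∈)` satisfies the axioms of ZFC. The instances of the two schemes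
are given by the classes which are first-order definable over `(M, ∈)` with parameters. -/
structure IsTransitiveModelZFC (M : Set ZFSet.{u}) : Prop where
  transitive : ∀ x ∈ M, ∀ y ∈ x, y ∈ M
  extensionality : ∀ x y : M, (∀ t : M, t.1 ∈ x.1 ↔ t.1 ∈ y.1) → x = y
  foundation : ∀ x : M, (∃ y : M, y.1 ∈ x.1) →
    ∃ y : M, y.1 ∈ x.1 ∧ ∀ t : M, t.1 ∈ y.1 → t.1 ∉ x.1
  pairing : ∀ x y : M, ∃ z : M, ∀ t : M, t.1 ∈ z.1 ↔ t = x ∨ t = y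
  union : ∀ x : M, ∃ z : M, ∀ t : M, t.1 ∈ z.1 ↔ ∃ y : M, y.1 ∈ x.1 ∧ t.1 ∈ y.1
  powerset : ∀ x : M, ∃ z : M, ∀ t : M, t.1 ∈ z.1 ↔ ∀ u : M, u.1 ∈ t.1 → u.1 ∈ x.1
  infinity : ∃ z : M, (∃ e : M, e.1 ∈ z.1 ∧ ∀ t : M, t.1 ∉ e.1) ∧
    ∀ x : M, x.1 ∈ z.1 → ∃ y : M, y.1 ∈ z.1 ∧ ∀ t : M, t.1 ∈ y.1 ↔ t.1 ∈ x.1 ∨ t = x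
  separation : ∀ S : Set M, (Set.univ : Set M).Definable₁ setLang S →
    ∀ x : M, ∃ z : M, ∀ t : M, t.1 ∈ z.1 ↔ t.1 ∈ x.1 ∧ t ∈ S
  replacement : ∀ R : Set (M × M), (Set.univ : Set M).Definable₂ setLang R →
    ∀ x : M, (∀ t : M, t.1 ∈ x.1 → ∃! u : M, (t, u) ∈ R) →
      ∃ z : M, ∀ u : M, u.1 ∈ z.1 ↔ ∃ t : M, t.1 ∈ x.1 ∧ (t, u) ∈ R
  choice : ∀ x : M, (∀ y : M, y.1 ∈ x.1 → ∃ t : M, t.1 ∈ y.1) →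
    (∀ y y' t : M, y.1 ∈ x.1 → y'.1 ∈ x.1 → t.1 ∈ y.1 → t.1 ∈ y'.1 → y = y') →
      ∃ c : M, ∀ y : M, y.1 ∈ x.1 → ∃! t : M, t.1 ∈ y.1 ∧ t.1 ∈ c.1

/-! ## Cofinitary groups and words -/

/-- Every element of `H` other than the identity has only finitely many fixed points. -/
def IsCofinitary (H : Subgroup (Equiv.Perm ℕ)) : Prop :=
  ∀ g ∈ H, g ≠ 1 → {n : ℕ | g n = n}.Finite

/-- Letters: elements of the group `𝒢`, the letter `X` (as `X true`) and its formal inverse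
(as `X false`). -/
inductive Letter (𝒢 : Subgroup (Equiv.Perm ℕ)) : Type
  | grp (g : 𝒢) : Letter 𝒢
  | X (sign : Bool) : Letter 𝒢

variable {𝒢 : Subgroup (Equiv.Perm ℕ)}

/-- The formal inverse of a letter. -/
def Letter.inv : Letter 𝒢 → Letter 𝒢
  | .grp g => .grp g⁻¹
  | .X i => .X (!i)

/-- The formal inverse of a string of letters. -/
def invList (w : List (Letter 𝒢)) : List (Letter 𝒢) := (w.map Letter.inv).reverse

/-- Two letters may stand next to each other in a reduced word: they are not both in the group,
and they are not `X` and its inverse. -/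
def Letter.Compat : Letter 𝒢 → Letter 𝒢 → Prop
  | .grp _, .grp _ => False
  | .X i, .X j => i = j
  | _, _ => True

/-- A string of letters is reduced. -/
def IsReducedWord (w : List (Letter 𝒢)) : Prop :=
  w.IsChain Letter.Compat ∧ Letter.grp 1 ∉ w

variable (𝒢) in
/-- The reduced words, i.e. the elements of the free product of `𝒢` and the free group on `X` in
normal form. The head of the list is the left-most letter. -/
def Word : Type := {w : List (Letter 𝒢) // IsReducedWord w}

/-- The element of the free product `𝒢 * 𝔽(X)` that a letter stands for. -/
def Letter.val : Letter 𝒢 → Monoid.Coprod 𝒢 (FreeGroup Unit)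
  | .grp g => Monoid.Coprod.inl g
  | .X true => Monoid.Coprod.inr (FreeGroup.of ())
  | .X false => Monoid.Coprod.inr (FreeGroup.of ())⁻¹

/-- The element of the free product `𝒢 * 𝔽(X)` that a word stands for. -/
def Word.val (w : Word 𝒢) : Monoid.Coprod 𝒢 (FreeGroup Unit) := (w.1.map Letter.val).prod

/-- `X` or its inverse occurs in the word, i.e. the word is not in `𝒢`. -/
def Word.HasX (w : Word 𝒢) : Prop := ∃ i, Letter.X i ∈ w.1

/-- `w` is, letter by letter, of the form `v⁻¹ u v` with `v` nonempty. -/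
def Word.HasProperConjSubword (w : Word 𝒢) : Prop :=
  ∃ v u : List (Letter 𝒢), v ≠ [] ∧ w.1 = invList v ++ u ++ v

/-- `w` is a proper power in the free product. -/
def Word.IsProperPower (w : Word 𝒢) : Prop :=
  ∃ v : Word 𝒢, ∃ n : ℕ, 2 ≤ n ∧ w.val = v.val ^ n

variable (𝒢) in
/-- The set `𝒢'` of words that do coding. -/
def CodingWord : Type :=
  {w : Word 𝒢 // ¬ w.HasProperConjSubword ∧ ¬ w.IsProperPower ∧ w.HasX}

/-! ## Evaluation and coding -/

/-- The partial injection that a letter becomes when `X` is replaced by `s`. -/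
def Letter.eval (s : ℕ ≃. ℕ) : Letter 𝒢 → (ℕ ≃. ℕ)
  | .grp g => (g : Equiv.Perm ℕ).toPEquiv
  | .X true => s
  | .X false => s.symm

/-- `w[s]`: replace `X` by `s` and compose as partial maps; the right-most letter acts first. -/
def evalList (s : ℕ ≃. ℕ) : List (Letter 𝒢) → (ℕ ≃. ℕ)
  | [] => PEquiv.refl ℕ
  | a :: w => (evalList s w).trans (a.eval s)

/-- The string `w ⋯ w` (`n` times); on words without proper conjugated subwords `X` never cancels
here. -/
def powList (w : List (Letter 𝒢)) (n : ℕ) : List (Letter 𝒢) := (List.replicate n w).flatten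

/-- The set of fixed points of a partial injection. -/
def fixSet (f : ℕ ≃. ℕ) : Set ℕ := {n | f n = some n}

/-- `(w, s)` codes the initial segment of length `l ≤ ω` of `z` with parameter `m`: for all
`k < l`, the value `w^{3k}[s](m)` is defined and has parity `z k`. -/
def Codes (w : List (Letter 𝒢)) (s : ℕ ≃. ℕ) (z : ℕ → Fin 2) (l : ℕ∞) (m : ℕ) : Prop :=
  ∀ k : ℕ, (k : ℕ∞) < l →
    ∃ v : ℕ, evalList s (powList w (3 * k)) m = some v ∧ v ≡ (z k : ℕ) [MOD 2]

/-- `(w, s)` exactly codes `z ↾ l` with parameter `m`: it codes it, and the path of `m` stops as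
soon as that is achieved, i.e. with `l = k + 1`, the right-most occurrence `X^{±1}` in
`w = t X^{±1} u` cannot be applied to `u w^{3k}[s](m)`. -/
def ExactlyCodes (w : List (Letter 𝒢)) (s : ℕ ≃. ℕ) (z : ℕ → Fin 2) (l m : ℕ) : Prop :=
  Codes w s z l m ∧
    ∃ k : ℕ, l = k + 1 ∧
      ∃ (t u : List (Letter 𝒢)) (i : Bool), w = t ++ Letter.X i :: u ∧
        (∀ j, Letter.X j ∉ u) ∧ evalList s (Letter.X i :: u ++ powList w (3 * k)) m = none

/-! ## The forcings -/

variable (𝒢) in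
/-- Conditions of Zhang's forcing: a finite partial injection and a finite set of words without
proper conjugated subwords. -/
structure ZhangCond where
  s : ℕ ≃. ℕ
  F : Set (Word 𝒢)
  s_finite : {n : ℕ | s n ≠ none}.Finite
  F_finite : F.Finite
  F_conj : ∀ w ∈ F, ¬ w.HasProperConjSubword

instance zhangPreorder : Preorder (ZhangCond 𝒢) where
  le q p := p.s ≤ q.s ∧ p.F ⊆ q.F ∧
    ∀ w ∈ p.F, w.HasX → fixSet (evalList q.s w.1) = fixSet (evalList p.s w.1)
  le_refl p := ⟨le_refl _, subset_rfl, fun _ _ _ => rfl⟩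
  le_trans r q p h₁ h₂ := ⟨h₂.1.trans h₁.1, h₂.2.1.trans h₁.2.1, fun w hw hX =>
    (h₁.2.2 w (h₂.2.1 hw) hX).trans (h₂.2.2 w hw hX)⟩

/-- Conditions of Zhang's forcing with coding: a condition of Zhang's forcing together with a
finite partial function `m` from `𝒢'` to `ω`, such that each `(w, s)` with `w` in the domain of `m`
exactly codes some initial segment of `z w` with parameter `m w`. -/
structure CodingCond (z : CodingWord 𝒢 → ℕ → Fin 2) extends ZhangCond 𝒢 where
  m : CodingWord 𝒢 → Option ℕ
  m_finite : {w | m w ≠ none}.Finite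
  exact_coding : ∀ w k, m w = some k → ∃ l : ℕ, ExactlyCodes w.1.1 s (z w) l k

instance codingPreorder (z : CodingWord 𝒢 → ℕ → Fin 2) : Preorder (CodingCond z) where
  le q p := q.toZhangCond ≤ p.toZhangCond ∧ ∀ w k, p.m w = some k → q.m w = some k
  le_refl p := ⟨le_refl _, fun _ _ h => h⟩
  le_trans _ _ _ h₁ h₂ := ⟨h₁.1.trans h₂.1, fun w k h => h₁.2 w k (h₂.2 w k h)⟩

/-! ## The objects above as sets, and genericity -/

/-- The von Neumann numeral. -/
noncomputable def natCode : ℕ → ZFSet.{u}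
  | 0 => ∅
  | n + 1 => insert (natCode n) (natCode n)

/-- The set of codes of the elements of `S`. -/
noncomputable def setCode {α : Type} (c : α → ZFSet.{u}) (S : Set α) : ZFSet.{u} :=
  ZFSet.range fun x : S => c x

/-- A partial injection of `ω`, as a set of ordered pairs. -/
noncomputable def pinjCode (s : ℕ ≃. ℕ) : ZFSet.{u} :=
  setCode (fun x : ℕ × ℕ => (natCode x.1).pair (natCode x.2)) {x | s x.1 = some x.2}

/-- A permutation of `ω`, as a set of ordered pairs. -/
noncomputable def permCode (g : Equiv.Perm ℕ) : ZFSet.{u} := pinjCode g.toPEquiv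

/-- A letter: `(0, g)` for an element of the group, `(1, 1)` for `X`, `(1, 0)` for its inverse. -/
noncomputable def letterCode : Letter 𝒢 → ZFSet.{u}
  | .grp g => (natCode 0).pair (permCode g)
  | .X true => (natCode 1).pair (natCode 1)
  | .X false => (natCode 1).pair (natCode 0)

/-- A word, as a finite sequence of letters. -/
noncomputable def wordCode (w : Word 𝒢) : ZFSet.{u} :=
  ZFSet.range fun i : Fin w.1.length => (natCode i).pair (letterCode (w.1.get i))

/-- An infinite binary sequence, as a function on `ω`. -/
noncomputable def seqCode (x : ℕ → Fin 2) : ZFSet.{u} :=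
  ZFSet.range fun n : ℕ => (natCode n).pair (natCode (x n))

/-- The group `𝒢`, as a set of permutations. -/
noncomputable def groupCode (𝒢 : Subgroup (Equiv.Perm ℕ)) : ZFSet.{u} :=
  setCode permCode (𝒢 : Set (Equiv.Perm ℕ))

/-- The map `z`, as a function on `𝒢'`. -/
noncomputable def mapCode (z : CodingWord 𝒢 → ℕ → Fin 2) : ZFSet.{u} :=
  ZFSet.range fun w : CodingWord 𝒢 => (wordCode w.1).pair (seqCode (z w))

/-- A condition, as a triple `(s, (F, m))`. -/
noncomputable def condCode {z : CodingWord 𝒢 → ℕ → Fin 2} (p : CodingCond z) : ZFSet.{u} :=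
  (pinjCode p.s).pair ((setCode wordCode p.F).pair
    (setCode (fun x : CodingWord 𝒢 × ℕ => (wordCode x.1.1).pair (natCode x.2))
      {x | p.m x.1 = some x.2}))

/-- A set of conditions is dense. -/
def IsDense {P : Type} [Preorder P] (D : Set P) : Prop := ∀ p, ∃ q ∈ D, q ≤ p

/-- The filter `G` is generic over `M`: it meets every dense set of conditions which belongs to
`M`. If `M` is a transitive model of ZFC with `𝒢, z ∈ M`, then the set of all conditions is in `M`
by absoluteness, so that the sets of conditions in `M` are precisely the sets
`{p | condCode p ∈ A}` with `A ∈ M`. -/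
def IsGeneric (M : Set ZFSet.{u}) {z : CodingWord 𝒢 → ℕ → Fin 2}
    (G : Order.PFilter (CodingCond z)) : Prop :=
  ∀ A ∈ M, IsDense {p : CodingCond z | condCode p ∈ A} → ∃ p ∈ G, condCode p ∈ A

end ZhangCoding

open ZhangCoding

/-!
The three properties of the generic permutation come from density arguments; the work is to see that
enough dense sets belong to the model and that the conditions can be extended.

*The model.* A condition is coded as a triple `(s, (F, m))`, and only dense sets of the form "the
coordinate `s` (or `F`, or `m`) contains an element of `a`" with `a ∈ M` are used. As the codes of
all conditions belong to a single set of `M` (`exists_condCode_bound`), such a dense set is cut out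
by one instance of separation (`exists_triple_meets`), and no absoluteness of the forcing is needed.
In particular it suffices for the coding that `w` enters the domain of `m` at some `p` in the
filter: the coding at each stronger condition in the filter is exact, while its path along `w`
becomes arbitrarily long (`codes_generic`).

*Words as moves.* Conjugating a word by its right-most group element turns it into a cyclic sequence
of moves "apply `s` or `s⁻¹`, then a group element". Without proper conjugated subwords this
sequence is cyclically reduced (`isReducedSeq_cycMoves`), so that a pair `(n, k)` with sufficiently
new `k` cannot be part of the closed path of a fixed point: the path could not be continued after
`k` (`fixSet_eq_of_isEdgeExt`). For a word that is not a proper power the length of the cyclic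
sequence is its least period, and hence the infinite sequence of moves and the right-most group
element determine the word (`CodingWord.eq_of_cycFun_eq`).

*Extending conditions.* When a new pair is added at a point where paths of coding words wait, these
paths make one more move and have to be led on to the end of a block of three rounds. Paths which
separate never meet again, since the values are new; so paths that wait at the same point have made
the same moves so far (`IsPartialExt.together`). If two of them complete a block simultaneously,
their sequences of moves agree on a common period, hence everywhere, and so their right-most group
elements differ (`eq_of_block_end`). Therefore the requirements on the parities concern the images
of the new value under distinct elements of `𝒢`, and the hypothesis on parities lets them be met
(`IsPartialExt.exists_step`). All paths in motion are extended up to the same number of moves, a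
common multiple of the lengths of the blocks (`IsPartialExt.exists_completion`).

*Agreement with `τ`.* For all but finitely many `n` the pair `(n, τ n)` is new in the above sense,
because `gτ ≠ 1` for `g ∈ 𝒢` and `⟨τ, 𝒢⟩` is cofinitary, and no path waits for it
(`CodingCond.exists_le_eq_apply`). The permutation `σ` itself differs from `τ` by genericity, so
`τ⁻¹σ` is a nontrivial element with infinitely many fixed points.
-/

namespace ZhangCoding

/-! ### Definability over a transitive model -/

section Model

variable {M : Set ZFSet.{u}}

/-- A property of assignments of the variables `v 0, v 1, …` which is expressed by a first-order
formula of set theory, interpreted in `(M, ∈)`. -/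
def IsFormulaProp (P : (ℕ → M) → Prop) : Prop :=
  ∃ φ : setLang.Formula ℕ, ∀ v : ℕ → M, φ.Realize v ↔ P v

/-- The membership symbol, as a relation symbol of the language of set theory. -/
def memSymbol : setLang.Relations 2 := MemRel.mem

namespace IsFormulaProp

variable {P Q : (ℕ → M) → Prop}

theorem mem (i j : ℕ) : IsFormulaProp fun v : ℕ → M => (v i).1 ∈ (v j).1 :=
  ⟨memSymbol.formula₂ (.var i) (.var j), fun _ =>
    FirstOrder.Language.Formula.realize_rel₂.trans Iff.rfl⟩

theorem eq (i j : ℕ) : IsFormulaProp fun v : ℕ → M => v i = v j :=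
  ⟨(FirstOrder.Language.Term.var i).equal (.var j), fun v => by simp⟩

theorem not (hP : IsFormulaProp P) : IsFormulaProp fun v => ¬ P v := by
  obtain ⟨φ, hφ⟩ := hP
  exact ⟨φ.not, fun v => by rw [FirstOrder.Language.Formula.realize_not, hφ]⟩

theorem and (hP : IsFormulaProp P) (hQ : IsFormulaProp Q) : IsFormulaProp fun v => P v ∧ Q v := by
  obtain ⟨φ, hφ⟩ := hP
  obtain ⟨ψ, hψ⟩ := hQ
  exact ⟨φ ⊓ ψ, fun v => by rw [FirstOrder.Language.Formula.realize_inf, hφ, hψ]⟩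

theorem or (hP : IsFormulaProp P) (hQ : IsFormulaProp Q) : IsFormulaProp fun v => P v ∨ Q v := by
  obtain ⟨φ, hφ⟩ := hP
  obtain ⟨ψ, hψ⟩ := hQ
  exact ⟨φ ⊔ ψ, fun v => by rw [FirstOrder.Language.Formula.realize_sup, hφ, hψ]⟩

theorem iff (hP : IsFormulaProp P) (hQ : IsFormulaProp Q) :
    IsFormulaProp fun v => (P v ↔ Q v) := by
  obtain ⟨φ, hφ⟩ := hP
  obtain ⟨ψ, hψ⟩ := hQ
  exact ⟨φ.iff ψ, fun v => by rw [FirstOrder.Language.Formula.realize_iff, hφ, hψ]⟩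

theorem ex (k : ℕ) (hP : IsFormulaProp P) :
    IsFormulaProp fun v => ∃ y, P (Function.update v k y) := by
  obtain ⟨φ, hφ⟩ := hP
  refine ⟨FirstOrder.Language.Formula.iExs Unit
    (φ.relabel fun n => if n = k then Sum.inr () else Sum.inl n), fun v => ?_⟩
  have key : ∀ y : M, (Sum.elim v fun _ : Unit => y) ∘
      (fun n => if n = k then Sum.inr () else Sum.inl n) = Function.update v k y := by
    intro y
    funext n
    by_cases h : n = k <;> simp [h]
  rw [FirstOrder.Language.Formula.realize_iExs]
  constructor
  · rintro ⟨i, hi⟩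
    rw [FirstOrder.Language.Formula.realize_relabel] at hi
    exact ⟨i (), by rw [← key, ← hφ]; exact hi⟩
  · rintro ⟨y, hy⟩
    refine ⟨fun _ => y, ?_⟩
    rw [FirstOrder.Language.Formula.realize_relabel, key, hφ]
    exact hy

theorem all (k : ℕ) (hP : IsFormulaProp P) :
    IsFormulaProp fun v => ∀ y, P (Function.update v k y) := by
  simpa using ((hP.not).ex k).not

end IsFormulaProp

/-- `z = {x, y}`, relativized to `M`. -/
def IsUPair (z x y : M) : Prop := ∀ t : M, t.1 ∈ z.1 ↔ t = x ∨ t = y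

/-- `z = (x, y)`, relativized to `M`. -/
def IsOPair (z x y : M) : Prop := ∃ a b : M, IsUPair a x x ∧ IsUPair b x y ∧ IsUPair z a b

/-- Any variable `k` other than `i`, `j`, `l` can serve as the bound one. -/
theorem isFormulaProp_isUPair (i j l k : ℕ) (hi : i ≠ k) (hj : j ≠ k) (hl : l ≠ k) :
    IsFormulaProp fun v : ℕ → M => IsUPair (v i) (v j) (v l) := by
  have := (((IsFormulaProp.mem (M := M) k i).iff
    ((IsFormulaProp.eq k j).or (IsFormulaProp.eq k l))).all k)
  simpa [IsUPair, hi, hj, hl] using this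

/-- The variables `20`, `21`, `22` are reserved for the quantifiers. -/
theorem isFormulaProp_isOPair (i j l : ℕ) (hi : i < 20) (hj : j < 20) (hl : l < 20) :
    IsFormulaProp fun v : ℕ → M => IsOPair (v i) (v j) (v l) := by
  have := ((((isFormulaProp_isUPair (M := M) 20 j j 22 (by omega) (by omega) (by omega)).and
    ((isFormulaProp_isUPair 21 j l 22 (by omega) (by omega) (by omega)).and
    (isFormulaProp_isUPair i 20 21 22 (by omega) (by omega) (by omega)))).ex 21).ex 20)
  have h1 : ∀ n < 20, n ≠ 20 := fun n hn => by omega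
  have h2 : ∀ n < 20, n ≠ 21 := fun n hn => by omega
  simpa [IsOPair, h1 _ hi, h1 _ hj, h1 _ hl, h2 _ hi, h2 _ hj, h2 _ hl] using this

/-! ### Sets that belong to a transitive model -/

namespace IsTransitiveModelZFC

variable (hM : IsTransitiveModelZFC M)
include hM

theorem mem_of_mem {x y : ZFSet.{u}} (hx : x ∈ M) (hy : y ∈ x) : y ∈ M := hM.transitive x hx y hy

theorem sep {P : (ℕ → M) → Prop} (hP : IsFormulaProp P) (c : ℕ → M) {B : ZFSet.{u}} (hB : B ∈ M) :
    ∃ A ∈ M, ∀ t : M, t.1 ∈ A ↔ t.1 ∈ B ∧ P (Function.update c 0 t) := by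
  obtain ⟨φ, hφ⟩ := hP
  obtain ⟨z, hz⟩ := hM.separation {t | P (Function.update c 0 t)} (by
    rw [Set.Definable₁, Set.definable_iff_exists_formula_sum]
    refine ⟨φ.relabel fun n => if n = 0 then Sum.inr 0 else Sum.inl ⟨c n, trivial⟩, ?_⟩
    ext v
    simp only [Set.mem_ofPred_eq, FirstOrder.Language.Formula.realize_relabel]
    rw [hφ]
    refine iff_of_eq (congrArg P ?_)
    funext n
    by_cases h : n = 0 <;> simp [h]) ⟨B, hB⟩
  exact ⟨z.1, z.2, hz⟩

theorem upair_mem {x y : ZFSet.{u}} (hx : x ∈ M) (hy : y ∈ M) : ({x, y} : ZFSet.{u}) ∈ M := by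
  obtain ⟨z, hz⟩ := hM.pairing ⟨x, hx⟩ ⟨y, hy⟩
  convert z.2
  ext t
  rw [ZFSet.mem_pair]
  constructor
  · rintro (rfl | rfl)
    · exact (hz ⟨t, hx⟩).2 (Or.inl rfl)
    · exact (hz ⟨t, hy⟩).2 (Or.inr rfl)
  · intro h
    simpa [Subtype.ext_iff] using (hz ⟨t, hM.mem_of_mem z.2 h⟩).1 h

theorem singleton_mem {x : ZFSet.{u}} (hx : x ∈ M) : ({x} : ZFSet.{u}) ∈ M := by
  have := hM.upair_mem hx hx
  rwa [show ({x, x} : ZFSet.{u}) = {x} by ext; simp] at this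

theorem pair_mem {x y : ZFSet.{u}} (hx : x ∈ M) (hy : y ∈ M) : x.pair y ∈ M :=
  hM.upair_mem (hM.singleton_mem hx) (hM.upair_mem hx hy)

theorem union_mem {x y : ZFSet.{u}} (hx : x ∈ M) (hy : y ∈ M) : x ∪ y ∈ M := by
  obtain ⟨z, hz⟩ := hM.union ⟨_, hM.upair_mem hx hy⟩
  convert z.2
  ext t
  rw [ZFSet.mem_union]
  constructor
  · rintro (h | h)
    · exact (hz ⟨t, hM.mem_of_mem hx h⟩).2 ⟨⟨x, hx⟩, by simp, h⟩
    · exact (hz ⟨t, hM.mem_of_mem hy h⟩).2 ⟨⟨y, hy⟩, by simp, h⟩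
  · intro h
    obtain ⟨w, hw, hw'⟩ := (hz ⟨t, hM.mem_of_mem z.2 h⟩).1 h
    rcases ZFSet.mem_pair.1 hw with h | h
    · exact Or.inl (h ▸ hw')
    · exact Or.inr (h ▸ hw')

theorem exists_natCode_mem : ∃ N ∈ M, ∀ n, natCode n ∈ N := by
  obtain ⟨z, ⟨e, he, he'⟩, hz⟩ := hM.infinity
  refine ⟨z.1, z.2, fun n => ?_⟩
  induction n with
  | zero =>
    have : e.1 = natCode 0 := by
      rw [natCode, ZFSet.eq_empty]
      exact fun t ht => he' ⟨t, hM.mem_of_mem e.2 ht⟩ ht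
    rwa [← this]
  | succ n ih =>
    obtain ⟨y, hy, hy'⟩ := hz ⟨_, hM.mem_of_mem z.2 ih⟩ ih
    have : y.1 = natCode (n + 1) := by
      ext t
      rw [natCode, ZFSet.mem_insert_iff]
      constructor
      · intro h
        simpa [Subtype.ext_iff, or_comm] using (hy' ⟨t, hM.mem_of_mem y.2 h⟩).1 h
      · rintro (rfl | h)
        · exact (hy' ⟨_, hM.mem_of_mem z.2 ih⟩).2 (Or.inr rfl)
        · exact (hy' ⟨t, hM.mem_of_mem (hM.mem_of_mem z.2 ih) h⟩).2 (Or.inl h)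
    rwa [← this]

theorem natCode_mem (n : ℕ) : natCode n ∈ M := by
  obtain ⟨N, hN, h⟩ := hM.exists_natCode_mem
  exact hM.mem_of_mem hN (h n)

/-- The power set of `M` contains all subsets that lie in `M`. -/
theorem exists_powerset {x : ZFSet.{u}} (hx : x ∈ M) : ∃ y ∈ M, ∀ t ∈ M, t ⊆ x → t ∈ y := by
  obtain ⟨z, hz⟩ := hM.powerset ⟨x, hx⟩
  exact ⟨z.1, z.2, fun t ht h => (hz ⟨t, ht⟩).2 fun u hu => h hu⟩

/-- A superset of the product `x × y` in `M`. -/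
theorem exists_pair_bound {x y : ZFSet.{u}} (hx : x ∈ M) (hy : y ∈ M) :
    ∃ b ∈ M, ∀ s ∈ x, ∀ t ∈ y, s.pair t ∈ b := by
  obtain ⟨p, hp, hp'⟩ := hM.exists_powerset (hM.union_mem hx hy)
  obtain ⟨q, hq, hq'⟩ := hM.exists_powerset hp
  refine ⟨q, hq, fun s hs t ht => ?_⟩
  have hsM := hM.mem_of_mem hx hs
  have htM := hM.mem_of_mem hy ht
  refine hq' _ (hM.pair_mem hsM htM) ?_
  intro r hr
  rw [ZFSet.pair, ZFSet.mem_pair] at hr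
  rcases hr with rfl | rfl
  · refine hp' _ (hM.singleton_mem hsM) fun a ha => ?_
    rw [ZFSet.mem_singleton] at ha
    exact ZFSet.mem_union.2 (Or.inl (ha ▸ hs))
  · refine hp' _ (hM.upair_mem hsM htM) fun a ha => ?_
    rcases ZFSet.mem_pair.1 ha with rfl | rfl
    · exact ZFSet.mem_union.2 (Or.inl hs)
    · exact ZFSet.mem_union.2 (Or.inr ht)

theorem range_mem_of_finite {ι : Type} [Finite ι] (c : ι → ZFSet.{u}) (hc : ∀ i, c i ∈ M) :
    ZFSet.range c ∈ M := by
  have key : ∀ S : Set ι, S.Finite → setCode c S ∈ M := by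
    intro S hS
    induction S, hS using Set.Finite.induction_on with
    | empty =>
      convert hM.natCode_mem 0
      rw [natCode, ZFSet.eq_empty]
      simp [setCode]
    | @insert a S _ _ ih =>
      convert hM.union_mem (hM.singleton_mem (hc a)) ih
      ext t
      simp [setCode, eq_comm]
  convert key Set.univ Set.finite_univ
  ext t
  simp [setCode]

theorem setCode_mem_of_finite {α : Type} (c : α → ZFSet.{u}) {S : Set α} (hS : S.Finite)
    (hc : ∀ i ∈ S, c i ∈ M) : setCode c S ∈ M := by
  have := hS.to_subtype
  exact hM.range_mem_of_finite _ fun i => hc i i.2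

/-- All codes of finite sets of objects whose codes are bounded belong to a single set of `M`. -/
theorem exists_setCode_bound {α : Type} (c : α → ZFSet.{u}) {B : ZFSet.{u}} (hB : B ∈ M)
    (hc : ∀ a, c a ∈ B) : ∃ C ∈ M, ∀ S : Set α, S.Finite → setCode c S ∈ C := by
  obtain ⟨C, hC, h⟩ := hM.exists_powerset hB
  refine ⟨C, hC, fun S hS => h _
    (hM.setCode_mem_of_finite c hS fun i _ => hM.mem_of_mem hB (hc i)) fun x hx => ?_⟩
  obtain ⟨i, rfl⟩ := ZFSet.mem_range.1 hx
  exact hc _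

theorem isUPair_iff (z x y : M) : IsUPair z x y ↔ z.1 = {x.1, y.1} := by
  constructor
  · intro h
    ext t
    rw [ZFSet.mem_pair]
    constructor
    · intro ht
      simpa [Subtype.ext_iff] using (h ⟨t, hM.mem_of_mem z.2 ht⟩).1 ht
    · rintro (rfl | rfl)
      · exact (h x).2 (Or.inl rfl)
      · exact (h y).2 (Or.inr rfl)
  · intro h t
    rw [h, ZFSet.mem_pair, Subtype.ext_iff, Subtype.ext_iff]

theorem isOPair_iff (z x y : M) : IsOPair z x y ↔ z.1 = x.1.pair y.1 := by
  have h1 : ({x.1, x.1} : ZFSet.{u}) = {x.1} := by ext; simp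
  constructor
  · rintro ⟨a, b, ha, hb, hz⟩
    rw [hM.isUPair_iff] at ha hb hz
    rw [hz, ha, hb, h1, ZFSet.pair]
  · intro h
    refine ⟨⟨_, hM.singleton_mem x.2⟩, ⟨_, hM.upair_mem x.2 y.2⟩, ?_⟩
    rw [hM.isUPair_iff, hM.isUPair_iff, hM.isUPair_iff]
    exact ⟨h1.symm, rfl, h⟩

theorem exists_sdiff {x y : ZFSet.{u}} (hx : x ∈ M) (hy : y ∈ M) :
    ∃ A ∈ M, ∀ t, t ∈ A ↔ t ∈ x ∧ t ∉ y := by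
  obtain ⟨A, hA, h⟩ := hM.sep (IsFormulaProp.mem 0 1).not (fun _ => ⟨y, hy⟩) hx
  refine ⟨A, hA, fun t => ⟨fun ht => ?_, fun ht => ?_⟩⟩
  · simpa using (h ⟨t, hM.mem_of_mem hA ht⟩).1 ht
  · exact (h ⟨t, hM.mem_of_mem hx ht.1⟩).2 (by simpa using ht)

/-- The set of those elements of `B` that are pairs with first coordinate `a`. -/
theorem exists_fst_eq {a B : ZFSet.{u}} (ha : a ∈ M) (hB : B ∈ M) :
    ∃ A ∈ M, ∀ t, t ∈ A ↔ t ∈ B ∧ ∃ y : ZFSet.{u}, t = a.pair y := by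
  obtain ⟨A, hA, h⟩ := hM.sep ((isFormulaProp_isOPair 0 1 2 (by omega) (by omega) (by omega)).ex 2)
    (fun _ => ⟨a, ha⟩) hB
  have h' : ∀ t : M, t.1 ∈ A ↔ t.1 ∈ B ∧ ∃ y : M, t.1 = a.pair y.1 := by
    intro t
    rw [h]
    simp [hM.isOPair_iff]
  refine ⟨A, hA, fun t => ⟨fun ht => ?_, fun ht => ?_⟩⟩
  · obtain ⟨h1, y, h2⟩ := (h' ⟨t, hM.mem_of_mem hA ht⟩).1 ht
    exact ⟨h1, y.1, h2⟩
  · obtain ⟨h1, y, rfl⟩ := ht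
    have h2 := hM.mem_of_mem hB h1
    have h3 : y ∈ M := hM.mem_of_mem (hM.mem_of_mem h2 (show {a, y} ∈ a.pair y by
      simp [ZFSet.pair])) (by simp)
    exact (h' ⟨_, h2⟩).2 ⟨h1, ⟨y, h3⟩, rfl⟩

theorem exists_snd_eq {a B : ZFSet.{u}} (ha : a ∈ M) (hB : B ∈ M) :
    ∃ A ∈ M, ∀ t, t ∈ A ↔ t ∈ B ∧ ∃ y : ZFSet.{u}, t = y.pair a := by
  obtain ⟨A, hA, h⟩ := hM.sep ((isFormulaProp_isOPair 0 2 1 (by omega) (by omega) (by omega)).ex 2)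
    (fun _ => ⟨a, ha⟩) hB
  have h' : ∀ t : M, t.1 ∈ A ↔ t.1 ∈ B ∧ ∃ y : M, t.1 = y.1.pair a := by
    intro t
    rw [h]
    simp [hM.isOPair_iff]
  refine ⟨A, hA, fun t => ⟨fun ht => ?_, fun ht => ?_⟩⟩
  · obtain ⟨h1, y, h2⟩ := (h' ⟨t, hM.mem_of_mem hA ht⟩).1 ht
    exact ⟨h1, y.1, h2⟩
  · obtain ⟨h1, y, rfl⟩ := ht
    have h2 := hM.mem_of_mem hB h1
    have h3 : y ∈ M := hM.mem_of_mem (hM.mem_of_mem h2 (show {y} ∈ y.pair a by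
      simp [ZFSet.pair])) (by simp)
    exact (h' ⟨_, h2⟩).2 ⟨h1, ⟨y, h3⟩, rfl⟩

/-- The set of those triples `(x, (y, t))` in `B` one of whose coordinates, singled out by `i`,
meets `a`. -/
theorem exists_triple_meets {a B : ZFSet.{u}} (ha : a ∈ M) (hB : B ∈ M) (i : Fin 3) :
    ∃ A ∈ M, ∀ x y t, x.pair (y.pair t) ∈ A ↔
      x.pair (y.pair t) ∈ B ∧ ∃ e ∈ (![x, y, t] : Fin 3 → ZFSet.{u}) i, e ∈ a := by
  -- variable `0` is the triple, `1` is `a`, and the coordinates are `3`, `4`, `5`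
  obtain ⟨A, hA, h⟩ := hM.sep
    (((((((isFormulaProp_isOPair 0 3 2 (by omega) (by omega) (by omega)).and
    (isFormulaProp_isOPair 2 4 5 (by omega) (by omega) (by omega))).and
    ((((IsFormulaProp.mem 6 (3 + i)).and (IsFormulaProp.mem 6 1))).ex 6)).ex 5).ex 4).ex 3).ex 2)
    (fun _ => ⟨a, ha⟩) hB
  refine ⟨A, hA, fun x y t => ?_⟩
  have key : ∀ T : M, T.1 ∈ A ↔ T.1 ∈ B ∧ ∃ r x y t : M, T.1 = x.1.pair r.1 ∧
      r.1 = y.1.pair t.1 ∧ ∃ e : M, e.1 ∈ (![x.1, y.1, t.1] : Fin 3 → ZFSet.{u}) i ∧ e.1 ∈ a := by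
    intro T
    rw [h]
    fin_cases i <;> simp [hM.isOPair_iff, Function.update, and_assoc]
  constructor
  · intro hT
    obtain ⟨h1, r, x', y', t', h2, h3, e, he, hea⟩ := (key ⟨_, hM.mem_of_mem hA hT⟩).1 hT
    refine ⟨h1, e.1, ?_, hea⟩
    rw [h3] at h2
    simp only [ZFSet.pair_inj] at h2
    obtain ⟨rfl, rfl, rfl⟩ := h2
    exact he
  · rintro ⟨h1, e, he, hea⟩
    have hmem : ∀ {p q : ZFSet.{u}}, p.pair q ∈ M → p ∈ M ∧ q ∈ M := by
      intro p q hpq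
      have := hM.mem_of_mem hpq (show {p, q} ∈ p.pair q by simp [ZFSet.pair])
      exact ⟨hM.mem_of_mem this (by simp), hM.mem_of_mem this (by simp)⟩
    have hT := hM.mem_of_mem hB h1
    obtain ⟨hx, hr⟩ := hmem hT
    obtain ⟨hy, ht⟩ := hmem hr
    exact (key ⟨_, hT⟩).2 ⟨h1, ⟨_, hr⟩, ⟨x, hx⟩, ⟨y, hy⟩, ⟨t, ht⟩, rfl, rfl,
      ⟨e, hM.mem_of_mem ha hea⟩, he, hea⟩

end IsTransitiveModelZFC

end Model

variable {𝒢 : Subgroup (Equiv.Perm ℕ)}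

/-! ### Injectivity of the codes -/

theorem mem_natCode {n : ℕ} {x : ZFSet.{u}} : x ∈ natCode n ↔ ∃ m < n, x = natCode m := by
  induction n with
  | zero => simp [natCode]
  | succ n ih =>
    rw [natCode, ZFSet.mem_insert_iff, ih]
    constructor
    · rintro (rfl | ⟨m, hm, rfl⟩)
      · exact ⟨n, by omega, rfl⟩
      · exact ⟨m, by omega, rfl⟩
    · rintro ⟨m, hm, rfl⟩
      rcases Nat.lt_succ_iff_lt_or_eq.1 hm with h | rfl
      · exact Or.inr ⟨m, h, rfl⟩
      · exact Or.inl rfl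

theorem natCode_injective : Function.Injective natCode.{u} := by
  have key : ∀ m n : ℕ, m < n → natCode.{u} m ≠ natCode n := fun m n h he =>
    ZFSet.mem_irrefl (natCode n) (mem_natCode.2 ⟨m, h, he.symm⟩)
  intro m n h
  rcases lt_trichotomy m n with h' | h' | h'
  · exact absurd h (key _ _ h')
  · exact h'
  · exact absurd h.symm (key _ _ h')

theorem mem_setCode {α : Type} {c : α → ZFSet.{u}} {S : Set α} {x : ZFSet.{u}} :
    x ∈ setCode c S ↔ ∃ a ∈ S, c a = x := by
  simp [setCode]

theorem pair_mem_pinjCode {s : ℕ ≃. ℕ} {n k : ℕ} :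
    (natCode n).pair (natCode k) ∈ pinjCode.{u} s ↔ s n = some k := by
  rw [pinjCode, mem_setCode]
  constructor
  · rintro ⟨⟨n', k'⟩, h, he⟩
    simp only [ZFSet.pair_inj, natCode_injective.eq_iff] at he
    obtain ⟨rfl, rfl⟩ := he
    exact h
  · intro h
    exact ⟨(n, k), h, rfl⟩

theorem pair_mem_permCode {g : Equiv.Perm ℕ} {n k : ℕ} :
    (natCode n).pair (natCode k) ∈ permCode.{u} g ↔ g n = k := by
  rw [permCode, pair_mem_pinjCode]
  simp [Equiv.toPEquiv_apply]

theorem permCode_injective : Function.Injective permCode.{u} := by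
  intro g h he
  ext n
  have := (pair_mem_permCode (g := g) (n := n) (k := g n)).2 rfl
  rw [he, pair_mem_permCode] at this
  exact this.symm

theorem letterCode_injective : Function.Injective (letterCode.{u} (𝒢 := 𝒢)) := by
  have h01 : natCode.{u} 0 ≠ natCode 1 := natCode_injective.ne (by decide)
  rintro (g | _ | _) (h | _ | _) he <;>
    simp_all [letterCode, h01.symm, permCode_injective.eq_iff]

theorem wordCode_injective : Function.Injective (wordCode.{u} (𝒢 := 𝒢)) := by
  have key : ∀ w w' : Word 𝒢, wordCode.{u} w = wordCode w' → ∀ i (hi : i < w.1.length),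
      ∃ hi' : i < w'.1.length, w.1[i] = w'.1[i] := by
    intro w w' he i hi
    have h1 : (natCode i).pair (letterCode w.1[i]) ∈ wordCode.{u} w :=
      ZFSet.mem_range.2 ⟨⟨i, hi⟩, rfl⟩
    rw [he] at h1
    obtain ⟨⟨j, hj⟩, h2⟩ := ZFSet.mem_range.1 h1
    simp only [ZFSet.pair_inj, natCode_injective.eq_iff, letterCode_injective.eq_iff] at h2
    obtain ⟨rfl, h3⟩ := h2
    exact ⟨hj, h3.symm⟩
  intro w w' he
  have hlen : ∀ w w' : Word 𝒢, wordCode.{u} w = wordCode w' → w.1.length ≤ w'.1.length := by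
    intro w w' he
    by_contra hlt
    obtain ⟨hi, _⟩ := key w w' he w'.1.length (by omega)
    omega
  refine Subtype.ext (List.ext_getElem (le_antisymm (hlen _ _ he) (hlen _ _ he.symm)) ?_)
  intro i hi _
  exact (key w w' he i hi).2

/-! ### Conditions and dense sets in the model -/

variable {M : Set ZFSet.{u}} {z : CodingWord 𝒢 → ℕ → Fin 2}

theorem PEquiv_graph_finite {s : ℕ ≃. ℕ} (hs : {n : ℕ | s n ≠ none}.Finite) :
    {x : ℕ × ℕ | s x.1 = some x.2}.Finite := by
  refine Set.Finite.of_finite_image (f := Prod.fst) (hs.subset ?_) ?_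
  · rintro _ ⟨x, hx, rfl⟩
    have hx : s x.1 = some x.2 := hx
    simp [hx]
  · rintro ⟨a, b⟩ hx ⟨a', b'⟩ hy rfl
    have hx : s a = some b := hx
    have hy : s a = some b' := hy
    rw [hx] at hy
    simpa using hy

theorem CodingCond.m_graph_finite (p : CodingCond z) :
    {x : CodingWord 𝒢 × ℕ | p.m x.1 = some x.2}.Finite := by
  refine Set.Finite.of_finite_image (f := Prod.fst) (p.m_finite.subset ?_) ?_
  · rintro _ ⟨x, hx, rfl⟩
    have hx : p.m x.1 = some x.2 := hx
    simp [hx]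
  · rintro ⟨a, b⟩ hx ⟨a', b'⟩ hy rfl
    have hx : p.m a = some b := hx
    have hy : p.m a = some b' := hy
    rw [hx] at hy
    simpa using hy

namespace IsTransitiveModelZFC

variable (hM : IsTransitiveModelZFC M)
include hM

theorem exists_wordCode_bound (h𝒢M : groupCode 𝒢 ∈ M) :
    ∃ W ∈ M, ∀ w : Word 𝒢, wordCode w ∈ W := by
  obtain ⟨N, hN, hN'⟩ := hM.exists_natCode_mem
  obtain ⟨L, hL, hL'⟩ := hM.exists_pair_bound hN (hM.union_mem hN h𝒢M)
  have hletter : ∀ a : Letter 𝒢, letterCode a ∈ L := by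
    rintro (g | _ | _)
    · exact hL' _ (hN' 0) _ (ZFSet.mem_union.2 (Or.inr (mem_setCode.2 ⟨_, g.2, rfl⟩)))
    · exact hL' _ (hN' 1) _ (ZFSet.mem_union.2 (Or.inl (hN' 0)))
    · exact hL' _ (hN' 1) _ (ZFSet.mem_union.2 (Or.inl (hN' 1)))
  obtain ⟨B, hB, hB'⟩ := hM.exists_pair_bound hN hL
  obtain ⟨W, hW, hW'⟩ := hM.exists_powerset hB
  refine ⟨W, hW, fun w => hW' _ (hM.range_mem_of_finite _ fun i =>
    hM.mem_of_mem hB (hB' _ (hN' _) _ (hletter _))) fun x hx => ?_⟩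
  obtain ⟨i, rfl⟩ := ZFSet.mem_range.1 hx
  exact hB' _ (hN' _) _ (hletter _)

theorem exists_condCode_bound (h𝒢M : groupCode 𝒢 ∈ M) :
    ∃ B ∈ M, ∀ p : CodingCond z, condCode p ∈ B := by
  obtain ⟨N, hN, hN'⟩ := hM.exists_natCode_mem
  obtain ⟨W, hW, hW'⟩ := hM.exists_wordCode_bound h𝒢M
  obtain ⟨NN, hNN, hNN'⟩ := hM.exists_pair_bound hN hN
  obtain ⟨WN, hWN, hWN'⟩ := hM.exists_pair_bound hW hN
  obtain ⟨S, hS, hS'⟩ := hM.exists_setCode_bound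
    (fun x : ℕ × ℕ => (natCode x.1).pair (natCode x.2)) hNN fun x => hNN' _ (hN' _) _ (hN' _)
  obtain ⟨F, hF, hF'⟩ := hM.exists_setCode_bound (wordCode (𝒢 := 𝒢)) hW hW'
  obtain ⟨m, hm, hm'⟩ := hM.exists_setCode_bound
    (fun x : CodingWord 𝒢 × ℕ => (wordCode x.1.1).pair (natCode x.2)) hWN
    fun x => hWN' _ (hW' _) _ (hN' _)
  obtain ⟨Fm, hFm, hFm'⟩ := hM.exists_pair_bound hF hm
  obtain ⟨B, hB, hB'⟩ := hM.exists_pair_bound hS hFm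
  exact ⟨B, hB, fun p => hB' _ (hS' _ (PEquiv_graph_finite p.s_finite)) _
    (hFm' _ (hF' _ p.F_finite) _ (hm' _ p.m_graph_finite))⟩

end IsTransitiveModelZFC

namespace IsGeneric

variable {G : Order.PFilter (CodingCond z)} (hG : IsGeneric M G)
  (hM : IsTransitiveModelZFC M) (h𝒢M : groupCode 𝒢 ∈ M)
include hG hM h𝒢M

/-- The generic filter contains a condition one of whose three coordinates (`c` is the `i`-th of
them) meets a given set of `M`, provided that such conditions are dense. -/
theorem exists_meets (i : Fin 3) (c : CodingCond z → ZFSet.{u})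
    (hc : ∀ p, (![pinjCode p.s, setCode wordCode p.F,
      setCode (fun x : CodingWord 𝒢 × ℕ => (wordCode x.1.1).pair (natCode x.2))
      {x | p.m x.1 = some x.2}] : Fin 3 → ZFSet.{u}) i = c p) {a : ZFSet.{u}} (ha : a ∈ M)
    (hd : ∀ p : CodingCond z, ∃ q ≤ p, ∃ e ∈ c q, e ∈ a) : ∃ p ∈ G, ∃ e ∈ c p, e ∈ a := by
  obtain ⟨B, hB, hB'⟩ := hM.exists_condCode_bound (z := z) h𝒢M
  obtain ⟨A, hA, hA'⟩ := hM.exists_triple_meets ha hB i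
  have key : ∀ p : CodingCond z, condCode p ∈ A ↔ ∃ e ∈ c p, e ∈ a := by
    intro p
    rw [← hc, condCode, hA']
    exact and_iff_right (hB' p)
  obtain ⟨p, hp, hpA⟩ := hG A hA fun p => by
    obtain ⟨q, hq, h⟩ := hd p
    exact ⟨q, (key q).2 h, hq⟩
  exact ⟨p, hp, (key p).1 hpA⟩

/-- If every condition can be extended so that a given set of `M` contains a pair of the finite
injection, then this is the case for some condition in the generic filter. -/
theorem exists_s_meets {a : ZFSet.{u}} (ha : a ∈ M)
    (hd : ∀ p : CodingCond z, ∃ q ≤ p, ∃ n k, q.s n = some k ∧ (natCode n).pair (natCode k) ∈ a) :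
    ∃ p ∈ G, ∃ n k, p.s n = some k ∧ (natCode n).pair (natCode k) ∈ a := by
  obtain ⟨p, hp, e, he, hea⟩ := hG.exists_meets hM h𝒢M 0
    (fun p => pinjCode p.s) (fun p => by simp) ha fun p => by
    obtain ⟨q, hq, n, k, h, h'⟩ := hd p
    exact ⟨q, hq, _, pair_mem_pinjCode.2 h, h'⟩
  obtain ⟨⟨n, k⟩, h, rfl⟩ := mem_setCode.1 he
  exact ⟨p, hp, n, k, h, hea⟩

theorem exists_mem_F (w : Word 𝒢) (hd : ∀ p : CodingCond z, ∃ q ≤ p, w ∈ q.F) :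
    ∃ p ∈ G, w ∈ p.F := by
  obtain ⟨W, hW, hW'⟩ := hM.exists_wordCode_bound h𝒢M
  obtain ⟨p, hp, e, he, hea⟩ := hG.exists_meets hM h𝒢M 1
    (fun p => setCode wordCode p.F) (fun p => by simp)
    (hM.singleton_mem (hM.mem_of_mem hW (hW' w))) fun p => by
      obtain ⟨q, hq, h⟩ := hd p
      exact ⟨q, hq, _, mem_setCode.2 ⟨w, h, rfl⟩, ZFSet.mem_singleton.2 rfl⟩
  obtain ⟨w', h, rfl⟩ := mem_setCode.1 he
  rw [ZFSet.mem_singleton, wordCode_injective.eq_iff] at hea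
  exact ⟨p, hp, hea ▸ h⟩

theorem exists_m_eq_some (w : CodingWord 𝒢)
    (hd : ∀ p : CodingCond z, ∃ q ≤ p, ∃ k, q.m w = some k) :
    ∃ p ∈ G, ∃ k, p.m w = some k := by
  obtain ⟨W, hW, hW'⟩ := hM.exists_wordCode_bound h𝒢M
  obtain ⟨N, hN, hN'⟩ := hM.exists_natCode_mem
  obtain ⟨WN, hWN, hWN'⟩ := hM.exists_pair_bound hW hN
  obtain ⟨a, ha, ha'⟩ := hM.exists_fst_eq (hM.mem_of_mem hW (hW' w.1)) hWN
  obtain ⟨p, hp, e, he, hea⟩ := hG.exists_meets hM h𝒢M 2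
    (fun p => setCode (fun x : CodingWord 𝒢 × ℕ => (wordCode x.1.1).pair (natCode x.2))
      {x | p.m x.1 = some x.2}) (fun p => by simp) ha fun p => by
    obtain ⟨q, hq, k, h⟩ := hd p
    exact ⟨q, hq, _, mem_setCode.2 ⟨(w, k), h, rfl⟩,
      (ha' _).2 ⟨hWN' _ (hW' _) _ (hN' _), _, rfl⟩⟩
  obtain ⟨⟨w', k⟩, h, rfl⟩ := mem_setCode.1 he
  obtain ⟨y, hy⟩ := ((ha' _).1 hea).2
  rw [ZFSet.pair_inj, wordCode_injective.eq_iff] at hy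
  have : w' = w := Subtype.ext hy.1
  exact ⟨p, hp, k, this ▸ h⟩

theorem exists_s_dom (n : ℕ) (hd : ∀ p : CodingCond z, ∃ q ≤ p, ∃ k, q.s n = some k) :
    ∃ p ∈ G, ∃ k, p.s n = some k := by
  obtain ⟨N, hN, hN'⟩ := hM.exists_natCode_mem
  obtain ⟨NN, hNN, hNN'⟩ := hM.exists_pair_bound hN hN
  obtain ⟨a, ha, ha'⟩ := hM.exists_fst_eq (hM.natCode_mem n) hNN
  obtain ⟨p, hp, n', k, h, hea⟩ := hG.exists_s_meets hM h𝒢M ha fun p => by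
    obtain ⟨q, hq, k, h⟩ := hd p
    exact ⟨q, hq, n, k, h, (ha' _).2 ⟨hNN' _ (hN' _) _ (hN' _), _, rfl⟩⟩
  obtain ⟨y, hy⟩ := ((ha' _).1 hea).2
  rw [ZFSet.pair_inj, natCode_injective.eq_iff] at hy
  exact ⟨p, hp, k, hy.1 ▸ h⟩

theorem exists_s_ran (k : ℕ) (hd : ∀ p : CodingCond z, ∃ q ≤ p, ∃ n, q.s n = some k) :
    ∃ p ∈ G, ∃ n, p.s n = some k := by
  obtain ⟨N, hN, hN'⟩ := hM.exists_natCode_mem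
  obtain ⟨NN, hNN, hNN'⟩ := hM.exists_pair_bound hN hN
  obtain ⟨a, ha, ha'⟩ := hM.exists_snd_eq (hM.natCode_mem k) hNN
  obtain ⟨p, hp, n, k', h, hea⟩ := hG.exists_s_meets hM h𝒢M ha fun p => by
    obtain ⟨q, hq, n, h⟩ := hd p
    exact ⟨q, hq, n, k, h, (ha' _).2 ⟨hNN' _ (hN' _) _ (hN' _), _, rfl⟩⟩
  obtain ⟨y, hy⟩ := ((ha' _).1 hea).2
  rw [ZFSet.pair_inj, natCode_injective.eq_iff] at hy
  exact ⟨p, hp, n, hy.2 ▸ h⟩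

theorem exists_s_ne {τ : Equiv.Perm ℕ} (hτ : permCode τ ∈ M)
    (hd : ∀ p : CodingCond z, ∃ q ≤ p, ∃ n k, q.s n = some k ∧ k ≠ τ n) :
    ∃ p ∈ G, ∃ n k, p.s n = some k ∧ k ≠ τ n := by
  obtain ⟨N, hN, hN'⟩ := hM.exists_natCode_mem
  obtain ⟨NN, hNN, hNN'⟩ := hM.exists_pair_bound hN hN
  obtain ⟨a, ha, ha'⟩ := hM.exists_sdiff hNN hτ
  obtain ⟨p, hp, n, k, h, hea⟩ := hG.exists_s_meets hM h𝒢M ha fun p => by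
    obtain ⟨q, hq, n, k, h, hne⟩ := hd p
    exact ⟨q, hq, n, k, h, (ha' _).2 ⟨hNN' _ (hN' _) _ (hN' _),
      fun hmem => hne (pair_mem_permCode.1 hmem).symm⟩⟩
  exact ⟨p, hp, n, k, h, fun he => ((ha' _).1 hea).2 (pair_mem_permCode.2 he.symm)⟩

theorem exists_s_eq_notMem {τ : Equiv.Perm ℕ} (hτ : permCode τ ∈ M) {E : Set ℕ} (hE : E.Finite)
    (hd : ∀ p : CodingCond z, ∃ q ≤ p, ∃ n ∉ E, q.s n = some (τ n)) :
    ∃ p ∈ G, ∃ n ∉ E, p.s n = some (τ n) := by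
  have hE' : setCode (fun n => (natCode n).pair (natCode (τ n))) E ∈ M :=
    hM.setCode_mem_of_finite _ hE fun n _ =>
      hM.pair_mem (hM.natCode_mem _) (hM.natCode_mem _)
  obtain ⟨a, ha, ha'⟩ := hM.exists_sdiff hτ hE'
  obtain ⟨p, hp, n, k, h, hea⟩ := hG.exists_s_meets hM h𝒢M ha fun p => by
    obtain ⟨q, hq, n, hn, h⟩ := hd p
    refine ⟨q, hq, n, τ n, h, (ha' _).2 ⟨pair_mem_permCode.2 rfl, fun hmem => ?_⟩⟩
    obtain ⟨n', hn', he⟩ := mem_setCode.1 hmem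
    rw [ZFSet.pair_inj, natCode_injective.eq_iff] at he
    exact hn (he.1 ▸ hn')
  obtain ⟨h1, h2⟩ := (ha' _).1 hea
  have h1 := pair_mem_permCode.1 h1
  subst h1
  exact ⟨p, hp, n, fun hn => h2 (mem_setCode.2 ⟨n, hn, rfl⟩), h⟩

end IsGeneric

variable {𝒢 : Subgroup (Equiv.Perm ℕ)}

/-! ### Words as sequences of moves -/

theorem pequiv_trans_apply (f g : ℕ ≃. ℕ) (x : ℕ) : f.trans g x = (f x).bind g := rfl

/-- The partial injection `s` if the sign is `true`, and its inverse otherwise. -/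
def dirEval (s : ℕ ≃. ℕ) : Bool → (ℕ ≃. ℕ)
  | true => s
  | false => s.symm

theorem dirEval_not_eq_some {s : ℕ ≃. ℕ} {b : Bool} {x y : ℕ} :
    dirEval s (!b) y = some x ↔ dirEval s b x = some y := by
  cases b
  · exact (PEquiv.eq_some_iff s).symm
  · exact PEquiv.eq_some_iff s

theorem dirEval_mono {s s' : ℕ ≃. ℕ} (h : s ≤ s') (b : Bool) : dirEval s b ≤ dirEval s' b := by
  cases b
  · intro y x hx
    exact (PEquiv.eq_some_iff s').2 (h x y ((PEquiv.eq_some_iff s).1 hx))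
  · exact h

theorem Letter.eval_X (s : ℕ ≃. ℕ) (b : Bool) :
    (Letter.X b : Letter 𝒢).eval s = dirEval s b := by
  cases b <;> rfl

/-- A move `(b, h)` of a point: first `s` or its inverse, according to `b`, and then `h`. -/
def move (s : ℕ ≃. ℕ) (m : Bool × 𝒢) (y : ℕ) : Option ℕ :=
  (dirEval s m.1 y).map (m.2 : Equiv.Perm ℕ)

theorem move_eq_some {s : ℕ ≃. ℕ} {m : Bool × 𝒢} {x y : ℕ} :
    move s m x = some y ↔ ∃ k, dirEval s m.1 x = some k ∧ (m.2 : Equiv.Perm ℕ) k = y := by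
  simp [move]

/-- The position of the point `y` after `t` moves of the infinite sequence `f` of moves. -/
def pos (s : ℕ ≃. ℕ) (f : ℕ → Bool × 𝒢) (y : ℕ) : ℕ → Option ℕ
  | 0 => some y
  | t + 1 => (pos s f y t).bind (move s (f t))

theorem pos_add (s : ℕ ≃. ℕ) (f : ℕ → Bool × 𝒢) (y t r : ℕ) :
    pos s f y (t + r) = (pos s f y t).bind fun y' => pos s (fun j => f (t + j)) y' r := by
  induction r with
  | zero => simp [pos]
  | succ r ih =>
    rw [← add_assoc, pos, ih, Option.bind_assoc]
    rfl

theorem move_mono {s s' : ℕ ≃. ℕ} (h : s ≤ s') (m : Bool × 𝒢) {x y : ℕ}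
    (hxy : move s m x = some y) : move s' m x = some y := by
  obtain ⟨k, hk, rfl⟩ := move_eq_some.1 hxy
  exact move_eq_some.2 ⟨k, dirEval_mono h _ _ _ hk, rfl⟩

theorem pos_mono {s s' : ℕ ≃. ℕ} (h : s ≤ s') (f : ℕ → Bool × 𝒢) {y t v : ℕ}
    (hv : pos s f y t = some v) : pos s' f y t = some v := by
  induction t generalizing v with
  | zero => exact hv
  | succ t ih =>
    rw [pos, Option.bind_eq_some_iff] at hv ⊢
    obtain ⟨u, hu, hv⟩ := hv
    exact ⟨u, ih hu, move_mono h _ hv⟩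

theorem pos_isSome_of_le {s : ℕ ≃. ℕ} {f : ℕ → Bool × 𝒢} {y t v : ℕ}
    (hv : pos s f y t = some v) {r : ℕ} (hr : r ≤ t) : ∃ u, pos s f y r = some u := by
  obtain ⟨k, rfl⟩ := Nat.exists_eq_add_of_le hr
  rw [pos_add, Option.bind_eq_some_iff] at hv
  obtain ⟨u, hu, -⟩ := hv
  exact ⟨u, hu⟩

/-- The moves of a string of letters, the last one being the head of the list, together with the
group element that is applied before the first move:
`a_L X^{ε_L} ⋯ a_1 X^{ε_1} a_0` gives `(a_0, [(ε_L, a_L), …, (ε_1, a_1)])`. -/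
def syl : List (Letter 𝒢) → 𝒢 × List (Bool × 𝒢)
  | [] => (1, [])
  | .grp g :: w =>
    match syl w with
    | (a, []) => (g * a, [])
    | (a, m :: l) => (a, (m.1, g * m.2) :: l)
  | .X b :: w => ((syl w).1, (b, 1) :: (syl w).2)

theorem evalList_eq_foldr (s : ℕ ≃. ℕ) (w : List (Letter 𝒢)) (x : ℕ) :
    evalList s w x = (syl w).2.foldr (fun m o => o.bind (move s m))
      (some (((syl w).1 : Equiv.Perm ℕ) x)) := by
  induction w with
  | nil => simp [evalList, syl, PEquiv.refl_apply]
  | cons a w ih =>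
    cases a with
    | grp g =>
      have h1 : evalList s (Letter.grp g :: w) x = (evalList s w x).map (g : Equiv.Perm ℕ) := by
        rw [evalList, pequiv_trans_apply, Option.map_eq_bind]
        rfl
      rw [h1, ih, syl]
      rcases syl w with ⟨a, _ | ⟨m, l⟩⟩
      · simp
      · simp only [List.foldr_cons]
        rcases l.foldr (fun m o => o.bind (move s m)) (some ((a : Equiv.Perm ℕ) x)) with _ | y
        · rfl
        · simp [move, Function.comp_def]
    | X b =>
      have h1 : evalList s (Letter.X b :: w) x = (evalList s w x).bind (dirEval s b) := by
        rw [evalList, pequiv_trans_apply, Letter.eval_X]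
      rw [h1, ih, syl]
      simp only [List.foldr_cons]
      congr 1
      funext y
      simp [move]

/-- The periodic sequence with period a given list (for the empty list, an irrelevant constant). -/
def cycFun (c : List (Bool × 𝒢)) (j : ℕ) : Bool × 𝒢 := c.getD (j % c.length) (true, 1)

theorem cycFun_add_length (c : List (Bool × 𝒢)) (j : ℕ) :
    cycFun c (j + c.length) = cycFun c j := by
  simp [cycFun]

theorem map_cycFun_range (c : List (Bool × 𝒢)) :
    (List.range c.length).map (cycFun c) = c := by
  refine List.ext_getElem (by simp) fun i h1 h2 => ?_
  simp [cycFun, Nat.mod_eq_of_lt h2, h2]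

theorem pos_eq_foldl (s : ℕ ≃. ℕ) (f : ℕ → Bool × 𝒢) (y t : ℕ) :
    pos s f y t = ((List.range t).map f).foldl (fun o m => o.bind (move s m)) (some y) := by
  induction t with
  | zero => rfl
  | succ t ih => rw [pos, ih, List.range_succ]; simp

/-- The group element that a word applies first. -/
def initElt (w : List (Letter 𝒢)) : 𝒢 := (syl w).1

/-- The cyclic sequence of moves of a word: the word is conjugated so that it begins with the
application of its right-most `X` or `X⁻¹`. -/
def cycMoves (w : List (Letter 𝒢)) : List (Bool × 𝒢) := (syl (.grp (initElt w) :: w)).2.reverse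

theorem evalList_append (s : ℕ ≃. ℕ) (w w' : List (Letter 𝒢)) :
    evalList s (w ++ w') = (evalList s w').trans (evalList s w) := by
  induction w with
  | nil => simp [evalList]
  | cons a w ih => rw [List.cons_append, evalList, ih, evalList, PEquiv.trans_assoc]

theorem syl_grp_cons_of_ne_nil (g : 𝒢) {w : List (Letter 𝒢)} (h : (syl w).2 ≠ []) :
    (syl (.grp g :: w)).1 = (syl w).1 := by
  rw [syl]
  rcases hw : syl w with ⟨a, _ | ⟨m, l⟩⟩
  · simp [hw] at h
  · rfl

theorem syl_snd_eq_nil_iff {w : List (Letter 𝒢)} : (syl w).2 = [] ↔ ∀ i, Letter.X i ∉ w := by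
  induction w with
  | nil => simp [syl]
  | cons a w ih =>
    cases a with
    | grp g =>
      simp only [List.mem_cons, reduceCtorEq, false_or]
      rw [← ih, syl]
      rcases syl w with ⟨a, _ | ⟨m, l⟩⟩ <;> simp
    | X b =>
      simp only [syl, reduceCtorEq, false_iff]
      intro h
      exact h b (by simp)

theorem pos_cycMoves_length (s : ℕ ≃. ℕ) {w : List (Letter 𝒢)} (hw : ∃ i, Letter.X i ∈ w) (x : ℕ) :
    pos s (cycFun (cycMoves w)) ((initElt w : Equiv.Perm ℕ) x) (cycMoves w).length =
      (evalList s w x).map (initElt w : Equiv.Perm ℕ) := by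
  have h0 : (syl w).2 ≠ [] := by
    rw [Ne, syl_snd_eq_nil_iff]
    push Not
    exact hw
  have h1 : evalList s (Letter.grp (initElt w) :: w) x =
      (evalList s w x).map (initElt w : Equiv.Perm ℕ) := by
    rw [evalList, pequiv_trans_apply, Option.map_eq_bind]
    rfl
  rw [← h1, evalList_eq_foldr, pos_eq_foldl, map_cycFun_range, cycMoves, List.foldl_reverse,
    syl_grp_cons_of_ne_nil _ h0]
  rfl

theorem cycFun_length_mul_add (c : List (Bool × 𝒢)) (i j : ℕ) :
    cycFun c (c.length * i + j) = cycFun c j := by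
  simp [cycFun]

/-- After `i` rounds of moves the position is `wⁱ[s](x)`, up to the initial group element. -/
theorem pos_cycMoves (s : ℕ ≃. ℕ) {w : List (Letter 𝒢)} (hw : ∃ i, Letter.X i ∈ w) (x i : ℕ) :
    pos s (cycFun (cycMoves w)) ((initElt w : Equiv.Perm ℕ) x) ((cycMoves w).length * i) =
      (evalList s (powList w i) x).map (initElt w : Equiv.Perm ℕ) := by
  induction i with
  | zero => simp [pos, powList, evalList, PEquiv.refl_apply]
  | succ i ih =>
    have h1 : powList w (i + 1) = w ++ powList w i := by
      simp [powList, List.replicate_succ]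
    rw [Nat.mul_succ, pos_add, ih, h1, evalList_append, pequiv_trans_apply]
    simp only [cycFun_length_mul_add]
    rcases evalList s (powList w i) x with _ | v
    · rfl
    · exact pos_cycMoves_length s hw v

/-! ### The moves of a reduced word -/

theorem IsReducedWord.tail {a : Letter 𝒢} {w : List (Letter 𝒢)} (h : IsReducedWord (a :: w)) :
    IsReducedWord w :=
  ⟨h.1.tail, fun h' => h.2 (List.mem_cons_of_mem _ h')⟩

theorem IsReducedWord.infix {w w' : List (Letter 𝒢)} (h : IsReducedWord w) (hw : w' <:+: w) :
    IsReducedWord w' :=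
  ⟨h.1.infix hw, fun h' => h.2 (hw.subset h')⟩

/-- The left-most move and the left-most letters of a reduced word determine each other. -/
theorem IsReducedWord.syl_cons {w : List (Letter 𝒢)} (hw : IsReducedWord w) {m : Bool × 𝒢}
    {l : List (Bool × 𝒢)} (h : (syl w).2 = m :: l) :
    (∃ w', w = .X m.1 :: w' ∧ m.2 = 1 ∧ (syl w').2 = l) ∨
      ∃ w', w = .grp m.2 :: .X m.1 :: w' ∧ m.2 ≠ 1 ∧ (syl w').2 = l := by
  rcases w with _ | ⟨_ | b, w⟩
  · simp [syl] at h
  · rename_i g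
    right
    have hg : g ≠ 1 := fun hg => hw.2 (by simp [hg])
    rcases w with _ | ⟨_ | b, w⟩
    · simp [syl] at h
    · exact absurd (List.isChain_cons_cons.1 hw.1).1 (by simp [Letter.Compat])
    · simp only [syl, mul_one, List.cons.injEq] at h
      obtain ⟨rfl, rfl⟩ := h
      exact ⟨w, rfl, hg, rfl⟩
  · left
    simp only [syl, List.cons.injEq] at h
    obtain ⟨rfl, rfl⟩ := h
    exact ⟨w, rfl, rfl, rfl⟩

theorem IsReducedWord.isChain_syl {w : List (Letter 𝒢)} (hw : IsReducedWord w) :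
    (syl w).2.IsChain fun m' m => m.2 = 1 → m'.1 = m.1 := by
  induction w with
  | nil => simp [syl]
  | cons a w ih =>
    have ih := ih hw.tail
    cases a with
    | grp g =>
      rw [syl]
      rcases h : syl w with ⟨a, _ | ⟨m, _ | ⟨m', l⟩⟩⟩
      · simp
      · simp
      · rw [h] at ih
        exact List.isChain_cons_cons.2 (List.isChain_cons_cons.1 ih)
    | X b =>
      rw [syl]
      rcases h : syl w with ⟨a, _ | ⟨m, l⟩⟩
      · simp
      · rw [h] at ih
        refine List.isChain_cons_cons.2 ⟨fun hm => ?_, ih⟩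
        rcases hw.tail.syl_cons (by rw [h]) with ⟨w', rfl, -⟩ | ⟨w', -, h', -⟩
        · exact (List.isChain_cons_cons.1 hw.1).1
        · exact absurd hm h'

theorem exists_last_X {w : List (Letter 𝒢)} (hw : ∃ i, Letter.X i ∈ w) :
    ∃ t u i, w = t ++ Letter.X i :: u ∧ ∀ j, Letter.X j ∉ u := by
  induction w with
  | nil => simp at hw
  | cons a w ih =>
    by_cases h : ∃ i, Letter.X i ∈ w
    · obtain ⟨t, u, i, rfl, h'⟩ := ih h
      exact ⟨a :: t, u, i, rfl, h'⟩
    · obtain ⟨i, hi⟩ := hw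
      push Not at h
      rcases List.mem_cons.1 hi with rfl | hi
      · exact ⟨[], w, i, rfl, h⟩
      · exact absurd hi (h i)

theorem syl_append_X (t u : List (Letter 𝒢)) (i : Bool) (hu : ∀ j, Letter.X j ∉ u) :
    ∃ l h, syl (t ++ Letter.X i :: u) = ((syl u).1, l ++ [(i, h)]) := by
  induction t with
  | nil => exact ⟨[], 1, by simp [syl, syl_snd_eq_nil_iff.2 hu]⟩
  | cons a t ih =>
    obtain ⟨l, h, ih⟩ := ih
    cases a with
    | grp g =>
      rw [List.cons_append, syl, ih]
      rcases l with _ | ⟨m, l⟩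
      · exact ⟨[], g * h, rfl⟩
      · exact ⟨(m.1, g * m.2) :: l, h, rfl⟩
    | X b => exact ⟨(b, 1) :: l, h, by rw [List.cons_append, syl, ih]; rfl⟩

theorem IsReducedWord.eq_of_no_X {w : List (Letter 𝒢)} (hw : IsReducedWord w)
    (h : ∀ j, Letter.X j ∉ w) :
    w = [] ∧ initElt w = 1 ∨ w = [.grp (initElt w)] ∧ initElt w ≠ 1 := by
  rcases w with _ | ⟨g | b, _ | ⟨g' | b', w⟩⟩
  · exact Or.inl ⟨rfl, rfl⟩
  · refine Or.inr ⟨by simp [initElt, syl], ?_⟩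
    simp only [initElt, syl, mul_one]
    exact fun hg => hw.2 (by simp [hg])
  · exact absurd (List.isChain_cons_cons.1 hw.1).1 (by simp [Letter.Compat])
  · exact absurd (by simp) (h b')
  all_goals exact absurd (by simp) (h b)

theorem cycMoves_ne_nil {w : List (Letter 𝒢)} (hw : ∃ i, Letter.X i ∈ w) : cycMoves w ≠ [] := by
  rw [cycMoves, Ne, List.reverse_eq_nil_iff, syl_snd_eq_nil_iff]
  push Not
  obtain ⟨i, hi⟩ := hw
  exact ⟨i, List.mem_cons_of_mem _ hi⟩

theorem cycMoves_length_pos {w : List (Letter 𝒢)} (hw : ∃ i, Letter.X i ∈ w) :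
    0 < (cycMoves w).length := List.length_pos_of_ne_nil (cycMoves_ne_nil hw)

theorem cycFun_zero_fst {t u : List (Letter 𝒢)} {i : Bool} (hu : ∀ j, Letter.X j ∉ u) :
    (cycFun (cycMoves (t ++ Letter.X i :: u)) 0).1 = i := by
  obtain ⟨l, h, hl⟩ := syl_append_X (.grp (initElt (t ++ Letter.X i :: u)) :: t) u i hu
  rw [List.cons_append] at hl
  rw [cycMoves, hl]
  simp [cycFun]

theorem initElt_append_X {t u : List (Letter 𝒢)} {i : Bool} (hu : ∀ j, Letter.X j ∉ u) :
    initElt (t ++ Letter.X i :: u) = initElt u := by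
  obtain ⟨l, h, hl⟩ := syl_append_X t u i hu
  rw [initElt, hl, initElt]

/-- A sequence of moves never undoes an application of `s`. -/
def IsReducedSeq (f : ℕ → Bool × 𝒢) : Prop := ∀ j, (f j).2 = 1 → (f (j + 1)).1 = (f j).1

/-- A word without proper conjugated subwords is cyclically reduced. Within one round this holds for
all reduced words; a cancellation at the junction of two rounds would give a word of the form
`X^{∓1} ⋯ X^{±1}` or `g⁻¹ ⋯ g`. -/
theorem isReducedSeq_cycMoves {w : Word 𝒢} (hX : w.HasX) (hc : ¬ w.HasProperConjSubword) :
    IsReducedSeq (cycFun (cycMoves w.1)) := by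
  obtain ⟨w, hw⟩ := w
  change ∃ i, Letter.X i ∈ w at hX
  have hne := cycMoves_length_pos hX
  intro j hj
  obtain ⟨m, l, hl⟩ := List.exists_cons_of_ne_nil
    (show (syl w).2 ≠ [] by rw [Ne, syl_snd_eq_nil_iff]; push Not; exact hX)
  have hcyc : cycMoves w = ((m.1, initElt w * m.2) :: l).reverse := by
    rw [cycMoves, syl]
    rcases h : syl w with ⟨a, l'⟩
    rw [h] at hl
    obtain rfl : l' = m :: l := hl
    rfl
  have hchain : (cycMoves w).IsChain fun m m' => m.2 = 1 → m'.1 = m.1 := by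
    rw [hcyc, List.isChain_reverse]
    have := hw.isChain_syl
    rw [hl] at this
    rcases l with _ | ⟨m', l⟩
    · simp
    · exact List.isChain_cons_cons.2 (List.isChain_cons_cons.1 this)
  rcases Nat.lt_or_ge (j % (cycMoves w).length + 1) (cycMoves w).length with hlt | hge
  · have h1 : cycFun (cycMoves w) j = (cycMoves w)[j % (cycMoves w).length] := by
      simp [cycFun, show j % (cycMoves w).length < (cycMoves w).length by omega]
    have h2 : cycFun (cycMoves w) (j + 1) = (cycMoves w)[j % (cycMoves w).length + 1] := by
      rw [cycFun, ← Nat.mod_add_mod, Nat.mod_eq_of_lt hlt]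
      simp [hlt]
    rw [h1] at hj
    rw [h1, h2]
    exact List.isChain_iff_getElem.1 hchain _ hlt hj
  · -- the junction of two rounds
    have hj' : j % (cycMoves w).length + 1 = (cycMoves w).length := by
      have := Nat.mod_lt j hne
      omega
    have h1 : cycFun (cycMoves w) j = (m.1, initElt w * m.2) := by
      rw [cycFun, show j % (cycMoves w).length = (cycMoves w).length - 1 by omega, hcyc]
      simp [List.getD]
    have h2 : cycFun (cycMoves w) (j + 1) = cycFun (cycMoves w) 0 := by
      rw [cycFun, ← Nat.mod_add_mod, hj', cycFun]
      simp
    rw [h1] at hj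
    rw [h1, h2]
    obtain ⟨t, u, i, hw', hu⟩ := exists_last_X hX
    have h3 : (cycFun (cycMoves w) 0).1 = i := by rw [hw', cycFun_zero_fst hu]
    have h4 : initElt w = initElt u := by rw [hw', initElt_append_X hu]
    rw [h3]
    rw [h4] at hj
    simp only at hj ⊢
    rcases (hw.infix (w' := u) ⟨t ++ [.X i], [], by simp [hw']⟩).eq_of_no_X hu with
      ⟨rfl, hu1⟩ | ⟨hu', hu1⟩
    · rw [hu1, one_mul] at hj
      rcases hw.syl_cons hl with ⟨w', hw'', -, -⟩ | ⟨w', -, h, -⟩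
      · rcases t with _ | ⟨a, t⟩
        · rw [hw'] at hw''
          simp at hw''
          exact hw''.1
        · by_contra hne
          refine hc ⟨[.X i], t, by simp, ?_⟩
          have h5 : a = .X m.1 := by
            rw [hw'] at hw''
            simp at hw''
            exact hw''.1
          have h6 : m.1 = !i := by
            revert hne
            cases i <;> cases m.1 <;> simp
          simp [invList, Letter.inv, hw', h5, h6]
      · exact absurd hj h
    · have hm : m.2 = (initElt u)⁻¹ := (inv_eq_of_mul_eq_one_right hj).symm
      rcases hw.syl_cons hl with ⟨w', hw'', h, -⟩ | ⟨w', hw'', -, -⟩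
      · rw [h] at hm
        exact absurd (inv_eq_one.1 hm.symm) hu1
      · exfalso
        rcases t with _ | ⟨a, t⟩
        · rw [hw'] at hw''
          simp at hw''
        · have h5 : a = .grp m.2 := by
            rw [hw'] at hw''
            simp at hw''
            exact hw''.1
          refine hc ⟨[.grp (initElt u)], t ++ [.X i], by simp, ?_⟩
          rw [hm] at h5
          change w = _
          rw [hw', h5]
          generalize initElt u = g at hu' ⊢
          subst hu'
          simp [invList, Letter.inv]

variable {𝒢 : Subgroup (Equiv.Perm ℕ)}

/-! ### Coding words are determined by their cyclic moves -/

/-- Every element of the free product is the value of a reduced word. -/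
theorem exists_reduced_val (l : List (Letter 𝒢)) :
    ∃ w : List (Letter 𝒢), IsReducedWord w ∧ (w.map Letter.val).prod = (l.map Letter.val).prod := by
  induction l with
  | nil => exact ⟨[], ⟨by simp, by simp⟩, rfl⟩
  | cons a l ih =>
    obtain ⟨w, hw, hwl⟩ := ih
    rw [List.map_cons, List.prod_cons, ← hwl]
    have hX : ∀ b, (Letter.X b : Letter 𝒢).val * (Letter.X (!b) : Letter 𝒢).val = 1 := by
      rintro (_ | _) <;> simp [Letter.val]
    rcases a with g | b
    · by_cases hg : g = 1
      · exact ⟨w, hw, by simp [hg, Letter.val]⟩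
      rcases w with _ | ⟨h | b, w⟩
      · exact ⟨[.grp g], ⟨by simp, by simpa using Ne.symm hg⟩, by simp⟩
      · by_cases hgh : g * h = 1
        · refine ⟨w, hw.tail, ?_⟩
          rw [List.map_cons, List.prod_cons, ← mul_assoc, Letter.val, Letter.val, ← map_mul, hgh]
          simp
        · refine ⟨.grp (g * h) :: w, ⟨?_, ?_⟩, ?_⟩
          · rcases w with _ | ⟨_ | b, w⟩
            · simp
            · exact absurd (List.isChain_cons_cons.1 hw.1).1 (by simp [Letter.Compat])
            · exact List.isChain_cons_cons.2 ⟨trivial, (List.isChain_cons_cons.1 hw.1).2⟩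
          · simp only [List.mem_cons, Letter.grp.injEq, not_or]
            exact ⟨fun h => hgh h.symm, hw.tail.2⟩
          · simp [Letter.val, mul_assoc]
      · refine ⟨.grp g :: .X b :: w, ⟨List.isChain_cons_cons.2 ⟨trivial, hw.1⟩, ?_⟩, by simp⟩
        rw [List.mem_cons, not_or]
        exact ⟨by simpa using Ne.symm hg, hw.2⟩
    · have hnot : ∀ w : List (Letter 𝒢), IsReducedWord w → Letter.grp 1 ∉ Letter.X b :: w := by
        intro w hw
        rw [List.mem_cons, not_or]
        exact ⟨by simp, hw.2⟩
      rcases w with _ | ⟨h | b', w⟩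
      · exact ⟨[.X b], ⟨by simp, hnot _ hw⟩, by simp⟩
      · exact ⟨.X b :: .grp h :: w, ⟨List.isChain_cons_cons.2 ⟨trivial, hw.1⟩, hnot _ hw⟩, by simp⟩
      · by_cases hb : b = b'
        · exact ⟨.X b :: .X b' :: w, ⟨List.isChain_cons_cons.2 ⟨hb, hw.1⟩, hnot _ hw⟩, by simp⟩
        · have hb' : b' = !b := by revert hb; cases b <;> cases b' <;> simp
          refine ⟨w, hw.tail, ?_⟩
          rw [List.map_cons, List.prod_cons, ← mul_assoc, hb', hX, one_mul]

/-- The element of the free product that a move stands for. -/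
def moveVal (m : Bool × 𝒢) : Monoid.Coprod 𝒢 (FreeGroup Unit) :=
  Monoid.Coprod.inl m.2 * (Letter.X m.1 : Letter 𝒢).val

theorem prod_val_eq (w : List (Letter 𝒢)) : (w.map Letter.val).prod =
    ((syl w).2.map moveVal).prod * Monoid.Coprod.inl (syl w).1 := by
  induction w with
  | nil => simp [syl]
  | cons a w ih =>
    rw [List.map_cons, List.prod_cons, ih]
    cases a with
    | grp g =>
      rw [syl]
      rcases syl w with ⟨a, _ | ⟨m, l⟩⟩
      · simp [Letter.val]
      · simp [Letter.val, moveVal, mul_assoc]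
    | X b => simp [syl, moveVal, mul_assoc]

/-- The product of the first `t` moves, the first one being the right-most factor. -/
def movesVal (f : ℕ → Bool × 𝒢) (t : ℕ) : Monoid.Coprod 𝒢 (FreeGroup Unit) :=
  (((List.range t).map f).reverse.map moveVal).prod

theorem movesVal_succ (f : ℕ → Bool × 𝒢) (t : ℕ) :
    movesVal f (t + 1) = moveVal (f t) * movesVal f t := by
  simp [movesVal, List.range_succ]

theorem movesVal_add (f : ℕ → Bool × 𝒢) (t r : ℕ) :
    movesVal f (t + r) = movesVal (fun j => f (t + j)) r * movesVal f t := by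
  induction r with
  | zero => simp [movesVal]
  | succ r ih => rw [← add_assoc, movesVal_succ, ih, movesVal_succ, mul_assoc]

theorem movesVal_mul {f : ℕ → Bool × 𝒢} {d : ℕ} (hf : Function.Periodic f d) (n : ℕ) :
    movesVal f (d * n) = movesVal f d ^ n := by
  induction n with
  | zero => simp [movesVal]
  | succ n ih =>
    have : (fun j => f (d * n + j)) = f := by
      funext j
      rw [add_comm, mul_comm]
      exact hf.nat_mul n j
    rw [Nat.mul_succ, movesVal_add, ih, this, pow_succ']

theorem val_eq_conj_movesVal {w : List (Letter 𝒢)} (hw : ∃ i, Letter.X i ∈ w) :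
    (w.map Letter.val).prod = (Monoid.Coprod.inl (initElt w))⁻¹ *
      movesVal (cycFun (cycMoves w)) (cycMoves w).length * Monoid.Coprod.inl (initElt w) := by
  have h0 : (syl w).2 ≠ [] := by
    rw [Ne, syl_snd_eq_nil_iff]
    push Not
    exact hw
  have h1 := prod_val_eq (.grp (initElt w) :: w)
  rw [List.map_cons, List.prod_cons, syl_grp_cons_of_ne_nil _ h0] at h1
  rw [movesVal, map_cycFun_range, cycMoves, List.reverse_reverse, mul_assoc, initElt]
  rw [initElt] at h1
  rw [← h1]
  simp [Letter.val]

theorem periodic_gcd {α : Type*} {f : ℕ → α} {a b : ℕ} (ha : Function.Periodic f a)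
    (hb : Function.Periodic f b) : Function.Periodic f (Nat.gcd a b) := by
  intro j
  rcases Nat.eq_zero_or_pos b with rfl | hb0
  · simpa using ha j
  rcases lt_or_eq_of_le (Nat.gcd_le_right a hb0) with h | h
  · obtain ⟨m, -, hm⟩ := Nat.exists_mul_mod_eq_gcd h
    have h1 : a * m = b * (a * m / b) + Nat.gcd a b := by
      rw [← hm, Nat.div_add_mod]
    generalize a * m / b = q at h1
    calc f (j + Nat.gcd a b) = f (j + Nat.gcd a b + q * b) := (hb.nat_mul _ _).symm
      _ = f (j + m * a) := by rw [mul_comm m a, h1]; congr 1; ring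
      _ = f j := ha.nat_mul _ _
  · rw [h]
    exact hb j

theorem cycFun_periodic (c : List (Bool × 𝒢)) : Function.Periodic (cycFun c) c.length :=
  cycFun_add_length c

/-- As a coding word is not a proper power, its number of moves is the least period of its cyclic
sequence of moves. -/
theorem CodingWord.length_dvd (w : CodingWord 𝒢) {d : ℕ} (hd : d ∣ (cycMoves w.1.1).length)
    (hf : Function.Periodic (cycFun (cycMoves w.1.1)) d) : d = (cycMoves w.1.1).length := by
  obtain ⟨⟨w, hw⟩, hc, hp, hX⟩ := w
  obtain ⟨n, hn⟩ := hd
  simp only at hn hf ⊢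
  have hpos : 0 < (cycMoves w).length := cycMoves_length_pos hX
  by_contra hne
  have hn2 : 2 ≤ n := by
    rcases n with _ | _ | n
    · rw [mul_zero] at hn; omega
    · exact absurd (by simpa using hn.symm) hne
    · omega
  have h1 := val_eq_conj_movesVal hX
  simp only at h1
  rw [hn, movesVal_mul hf] at h1
  have h2 : ∃ l : List (Letter 𝒢), (l.map Letter.val).prod = (Monoid.Coprod.inl (initElt w))⁻¹ *
      movesVal (cycFun (cycMoves w)) d * Monoid.Coprod.inl (initElt w) := by
    refine ⟨.grp (initElt w)⁻¹ :: (((List.range d).map (cycFun (cycMoves w))).reverse.flatMap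
      fun m => [.grp m.2, .X m.1]) ++ [.grp (initElt w)], ?_⟩
    rw [movesVal]
    generalize ((List.range d).map (cycFun (cycMoves w))).reverse = l
    have : ((l.flatMap fun m => [Letter.grp m.2, Letter.X m.1]).map Letter.val).prod =
        (l.map moveVal).prod := by
      induction l with
      | nil => rfl
      | cons m l ih =>
        simp only [List.flatMap_cons, List.map_append, List.prod_append, ih, List.map_cons,
          List.prod_cons]
        simp [moveVal, Letter.val]
    simp [Letter.val, this, mul_assoc]
  obtain ⟨l, hl⟩ := h2
  obtain ⟨v, hv, hvl⟩ := exists_reduced_val l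
  refine hp ⟨⟨v, hv⟩, n, hn2, ?_⟩
  change (w.map Letter.val).prod = (v.map Letter.val).prod ^ n
  rw [h1, hvl, hl]
  have := conj_pow (i := n) (a := (Monoid.Coprod.inl (initElt w))⁻¹)
    (b := movesVal (cycFun (cycMoves w)) d)
  rw [inv_inv] at this
  exact this.symm

theorem IsReducedWord.eq_of_syl_eq {w w' : List (Letter 𝒢)} (hw : IsReducedWord w)
    (hw' : IsReducedWord w') (h : syl w = syl w') : w = w' := by
  have key : ∀ n, ∀ w w' : List (Letter 𝒢), (syl w).2.length = n → IsReducedWord w →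
      IsReducedWord w' → syl w = syl w' → w = w' := by
    intro n
    induction n with
    | zero =>
      intro w w' hn hw hw' h
      have h1 := List.length_eq_zero_iff.1 hn
      have h2 := h1
      rw [h] at h2
      have h3 : initElt w = initElt w' := by rw [initElt, h, initElt]
      rcases hw.eq_of_no_X (syl_snd_eq_nil_iff.1 h1) with ⟨h4, h5⟩ | ⟨h4, h5⟩ <;>
      rcases hw'.eq_of_no_X (syl_snd_eq_nil_iff.1 h2) with ⟨h6, h7⟩ | ⟨h6, h7⟩
      · rw [h4, h6]
      · exact absurd (h3 ▸ h5) h7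
      · exact absurd (h3 ▸ h7) h5
      · rw [h4, h6, h3]
    | succ n ih =>
      intro w w' hn hw hw' h
      obtain ⟨m, l, hl⟩ := List.exists_cons_of_ne_nil (List.ne_nil_of_length_eq_add_one hn)
      have hl' := hl
      rw [h] at hl'
      have hlen : l.length = n := by rw [hl] at hn; simpa using hn
      rcases hw.syl_cons hl with ⟨v, rfl, h1, h2⟩ | ⟨v, rfl, h1, h2⟩ <;>
      rcases hw'.syl_cons hl' with ⟨v', rfl, h1', h2'⟩ | ⟨v', rfl, h1', h2'⟩
      · rw [ih v v' (by rw [h2, hlen]) hw.tail hw'.tail 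
          (Prod.ext (by simpa [syl] using congrArg Prod.fst h) (h2.trans h2'.symm))]
      · exact absurd h1 h1'
      · exact absurd h1' h1
      · rw [ih v v' (by rw [h2, hlen]) hw.tail.tail hw'.tail.tail
          
          (Prod.ext (by simpa [syl] using congrArg Prod.fst h) (h2.trans h2'.symm))]
  exact key _ w w' rfl hw hw' h

/-- A coding word is determined by its infinite sequence of moves and its initial group element. -/
theorem CodingWord.eq_of_cycFun_eq {w w' : CodingWord 𝒢}
    (hf : cycFun (cycMoves w.1.1) = cycFun (cycMoves w'.1.1))
    (ha : initElt w.1.1 = initElt w'.1.1) : w = w' := by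
  have hg := periodic_gcd (cycFun_periodic (cycMoves w.1.1))
    (hf ▸ cycFun_periodic (cycMoves w'.1.1))
  have h1 := w.length_dvd (Nat.gcd_dvd_left _ _) hg
  have h2 := w'.length_dvd (Nat.gcd_dvd_right (cycMoves w.1.1).length _) (hf ▸ hg)
  have h3 : cycMoves w.1.1 = cycMoves w'.1.1 := by
    rw [← map_cycFun_range (cycMoves w.1.1), ← map_cycFun_range (cycMoves w'.1.1), hf,
      h1.symm.trans h2]
  refine Subtype.ext (Subtype.ext (w.1.2.eq_of_syl_eq w'.1.2 (Prod.ext ha ?_)))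
  have h4 := List.reverse_injective h3
  rw [syl, syl, ← ha] at h4
  obtain ⟨m, l, hl⟩ := List.exists_cons_of_ne_nil
    (show (syl w.1.1).2 ≠ [] by rw [Ne, syl_snd_eq_nil_iff]; push Not; exact w.2.2.2)
  obtain ⟨m', l', hl'⟩ := List.exists_cons_of_ne_nil
    (show (syl w'.1.1).2 ≠ [] by rw [Ne, syl_snd_eq_nil_iff]; push Not; exact w'.2.2.2)
  generalize initElt w.1.1 = g at h4
  rcases h5 : syl w.1.1 with ⟨a, x⟩
  rcases h6 : syl w'.1.1 with ⟨a', x'⟩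
  rw [h5] at h4 hl
  rw [h6] at h4 hl'
  simp only at hl hl'
  subst hl hl'
  simp only [List.cons.injEq, Prod.mk.injEq, mul_right_inj] at h4
  simp only [List.cons.injEq]
  exact ⟨Prod.ext h4.1.1 h4.1.2, h4.2⟩

variable {𝒢 : Subgroup (Equiv.Perm ℕ)}

/-! ### Adding a pair to a finite partial injection -/

/-- `s'` is `s` together with a new pair, by which `n` is mapped to `k` in the direction `b`. -/
structure IsEdgeExt (s s' : ℕ ≃. ℕ) (b : Bool) (n k : ℕ) : Prop where
  le : s ≤ s'
  eq_some : dirEval s' b n = some k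
  cases : ∀ c x y, dirEval s' c x = some y →
    dirEval s c x = some y ∨ (c = b ∧ x = n ∧ y = k) ∨ (c = !b ∧ x = k ∧ y = n)

theorem exists_isEdgeExt_true {s : ℕ ≃. ℕ} {n k : ℕ} (hn : s n = none) (hk : s.symm k = none) :
    ∃ s', IsEdgeExt s s' true n k := by
  classical
  have hs : ∀ x y, y ∈ s x ↔ x ∈ s.symm y := fun x y => (PEquiv.mem_iff_mem s).symm
  let s' : ℕ ≃. ℕ :=
    { toFun := fun x => if x = n then some k else s x
      invFun := fun y => if y = k then some n else s.symm y
      inv := by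
        intro x y
        have h1 : n ∉ s.symm y := fun h => by
          have := (hs _ _).2 h
          rw [hn] at this
          cases this
        have h2 : k ∉ s x := fun h => by
          have := (hs _ _).1 h
          rw [hk] at this
          cases this
        by_cases hx : x = n <;> by_cases hy : y = k <;> simp_all [eq_comm] }
  have hs' : ∀ x, s' x = if x = n then some k else s x := fun x => rfl
  have hs'' : ∀ y, s'.symm y = if y = k then some n else s.symm y := fun y => rfl
  refine ⟨s', ?_, by simp [dirEval, hs'], ?_⟩
  · intro x y hxy
    have : x ≠ n := by rintro rfl; simp [hn] at hxy
    simpa [hs', this] using hxy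
  · rintro (_ | _) x y h
    · simp only [dirEval, hs''] at h
      split_ifs at h with hx
      · exact Or.inr (Or.inr ⟨rfl, hx, by simpa using h.symm⟩)
      · exact Or.inl h
    · simp only [dirEval, hs'] at h
      split_ifs at h with hx
      · exact Or.inr (Or.inl ⟨rfl, hx, by simpa using h.symm⟩)
      · exact Or.inl h

theorem exists_isEdgeExt {s : ℕ ≃. ℕ} {b : Bool} {n k : ℕ} (hn : dirEval s b n = none)
    (hk : dirEval s (!b) k = none) : ∃ s', IsEdgeExt s s' b n k := by
  cases b
  · obtain ⟨s', h1, h2, h3⟩ := exists_isEdgeExt_true hk hn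
    refine ⟨s', h1, dirEval_not_eq_some (b := true).2 h2, fun c x y h => ?_⟩
    rcases h3 c x y h with h | h | h
    · exact Or.inl h
    · exact Or.inr (Or.inr h)
    · exact Or.inr (Or.inl h)
  · exact exists_isEdgeExt_true hn hk

theorem dirEval_finite {s : ℕ ≃. ℕ} (hs : {n : ℕ | s n ≠ none}.Finite) (b : Bool) :
    {n : ℕ | dirEval s b n ≠ none}.Finite := by
  cases b
  · refine (hs.image fun n => (s n).getD 0).subset fun k hk => ?_
    obtain ⟨n, hn⟩ := Option.ne_none_iff_exists'.1 hk
    have hn' : s n = some k := (PEquiv.eq_some_iff s).1 hn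
    exact ⟨n, by simp [hn'], by simp [hn']⟩
  · exact hs

theorem IsEdgeExt.finite {s s' : ℕ ≃. ℕ} {b : Bool} {n k : ℕ} (h : IsEdgeExt s s' b n k)
    (hs : {n : ℕ | s n ≠ none}.Finite) : {n : ℕ | s' n ≠ none}.Finite := by
  refine (hs.union ((Set.finite_singleton n).union (Set.finite_singleton k))).subset fun x hx => ?_
  obtain ⟨y, hy⟩ := Option.ne_none_iff_exists'.1 hx
  rcases h.cases true x y hy with h | ⟨-, rfl, -⟩ | ⟨-, rfl, -⟩
  · left
    change s x ≠ none
    rw [show s x = some y from h]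
    simp
  · simp
  · simp

/-- The target `k` of a new pair with source `n` is free of interference with `s` and with the
group elements in `A`: after `k` has been reached, no `g ∈ A` leads to a point where `s` or the new
pair could be applied, except for the new pair backwards, which requires `g = 1`. -/
def IsFree (A : Set 𝒢) (s : ℕ ≃. ℕ) (n k : ℕ) : Prop :=
  ∀ g ∈ A, (∀ c, dirEval s c ((g : Equiv.Perm ℕ) k) = none) ∧ (g : Equiv.Perm ℕ) k ≠ n ∧
    ((g : Equiv.Perm ℕ) k = k → g = 1)

/-- All but finitely many points are free, as `𝒢` is cofinitary. -/
theorem finite_not_isFree (h𝒢 : IsCofinitary 𝒢) {A : Set 𝒢} (hA : A.Finite) {s : ℕ ≃. ℕ}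
    (hs : {n : ℕ | s n ≠ none}.Finite) (n : ℕ) : {k | ¬ IsFree A s n k}.Finite := by
  have h1 : {k | ¬ IsFree A s n k} ⊆ ⋃ g ∈ A,
      ((g : Equiv.Perm ℕ) ⁻¹' {x | dirEval s true x ≠ none} ∪
      (g : Equiv.Perm ℕ) ⁻¹' {x | dirEval s false x ≠ none} ∪ (g : Equiv.Perm ℕ) ⁻¹' {n} ∪
      {k | (g : Equiv.Perm ℕ) k = k ∧ g ≠ 1}) := by
    intro k hk
    simp only [IsFree, Set.mem_ofPred_eq] at hk
    push Not at hk
    obtain ⟨g, hg, hk⟩ := hk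
    refine Set.mem_biUnion hg ?_
    by_contra hcon
    simp only [Set.mem_union, Set.mem_preimage, Set.mem_ofPred_eq, Set.mem_singleton_iff, not_or,
      not_not] at hcon
    obtain ⟨⟨⟨h1, h2⟩, h3⟩, h4⟩ := hcon
    exact h4 (hk (by rintro (_ | _) <;> assumption) h3)
  refine (hA.biUnion fun g _ => ?_).subset h1
  have hinj := (g : Equiv.Perm ℕ).injective
  refine ((((dirEval_finite hs _).preimage hinj.injOn).union
    ((dirEval_finite hs _).preimage hinj.injOn)).union
    ((Set.finite_singleton n).preimage hinj.injOn)).union ?_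
  by_cases hg : g = 1
  · simp [hg]
  · exact (h𝒢 g g.2 (by simpa using hg)).subset fun k hk => hk.1

/-! ### Fixed points of words -/

theorem powList_eval_fixed {s : ℕ ≃. ℕ} {w : List (Letter 𝒢)} {x : ℕ}
    (h : evalList s w x = some x) (i : ℕ) : evalList s (powList w i) x = some x := by
  induction i with
  | zero => simp [powList, evalList, PEquiv.refl_apply]
  | succ i ih =>
    rw [show powList w (i + 1) = w ++ powList w i by simp [powList, List.replicate_succ],
      evalList_append, pequiv_trans_apply, ih]
    exact h

theorem evalList_mono {s s' : ℕ ≃. ℕ} (h : s ≤ s') (w : List (Letter 𝒢)) :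
    evalList s w ≤ evalList s' w := by
  induction w with
  | nil => exact le_refl _
  | cons a w ih =>
    intro x y hxy
    change (evalList s w x).bind (a.eval s) = some y at hxy
    change (evalList s' w x).bind (a.eval s') = some y
    rw [Option.bind_eq_some_iff] at hxy ⊢
    obtain ⟨v, hv, hy⟩ := hxy
    refine ⟨v, ih _ _ hv, ?_⟩
    cases a with
    | grp g => exact hy
    | X b =>
      rw [Letter.eval_X] at hy ⊢
      exact dirEval_mono h b _ _ hy

/-- Adding a pair with a free target creates no new fixed point of a cyclically reduced word: the
closed path of a new fixed point would have to get past the target `k` in one direction or the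
other. -/
theorem fixSet_eq_of_isEdgeExt {s s' : ℕ ≃. ℕ} {b : Bool} {n k : ℕ} (h : IsEdgeExt s s' b n k)
    {w : Word 𝒢} (hX : w.HasX) (hc : ¬ w.HasProperConjSubword) {A : Set 𝒢}
    (hA : ∀ j, (cycFun (cycMoves w.1) j).2 ∈ A ∧ (cycFun (cycMoves w.1) j).2⁻¹ ∈ A)
    (hk : IsFree A s n k) : fixSet (evalList s' w.1) = fixSet (evalList s w.1) := by
  refine Set.Subset.antisymm (fun x hx => ?_) fun x hx => evalList_mono h.le _ _ _ hx
  change evalList s' w.1 x = some x at hx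
  have hred := isReducedSeq_cycMoves hX hc
  have hLpos := cycMoves_length_pos hX
  have hper := cycFun_add_length (cycMoves w.1)
  have hL := fun i => pos_cycMoves s' hX x i
  simp only [powList_eval_fixed hx, Option.map_some] at hL
  have hback := pos_cycMoves s hX x 1
  set f := cycFun (cycMoves w.1)
  set L := (cycMoves w.1).length
  set y₀ := (initElt w.1 : Equiv.Perm ℕ) x with hy₀
  have hdef : ∀ t, ∃ y, pos s' f y₀ t = some y := fun t =>
    pos_isSome_of_le (hL t) (Nat.le_mul_of_pos_left t hLpos)
  choose y hy using hdef
  have hmove : ∀ t, ∃ v, dirEval s' (f t).1 (y t) = some v ∧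
      ((f t).2 : Equiv.Perm ℕ) v = y (t + 1) := by
    intro t
    have := hy (t + 1)
    rw [pos, hy t] at this
    exact move_eq_some.1 this
  choose v hv hv' using hmove
  have hyper : ∀ t, y (t + L) = y t := by
    intro t
    have h1 := hy (t + L)
    have h2 : pos s' f y₀ L = some y₀ := by simpa using hL 1
    have h3 : (fun j => f (L + j)) = f := by
      funext j
      rw [add_comm, hper]
    rw [add_comm, pos_add, h2] at h1
    change pos s' (fun j => f (L + j)) y₀ t = _ at h1
    rw [h3, hy t] at h1
    simpa [add_comm] using h1.symm
  -- after the new pair has been used forwards, there is no next move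
  have hfwd : ∀ t, ¬ ((f t).1 = b ∧ y t = n ∧ v t = k) := by
    rintro t ⟨h1, -, h3⟩
    obtain ⟨hf1, hf2, hf3⟩ := hk _ (hA t).1
    have h4 := hv (t + 1)
    rw [← hv' t, h3] at h4
    rcases h.cases _ _ _ h4 with h5 | ⟨-, h5, -⟩ | ⟨h5, h6, -⟩
    · rw [hf1] at h5
      cases h5
    · exact hf2 h5
    · have := hred t (hf3 h6)
      rw [h5, h1] at this
      simp at this
  -- before the new pair is used backwards, there is no preceding move
  have hbwd : ∀ t, ¬ ((f (t + 1)).1 = !b ∧ y (t + 1) = k ∧ v (t + 1) = n) := by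
    rintro t ⟨h1, h2, -⟩
    obtain ⟨hf1, hf2, hf3⟩ := hk _ (hA t).2
    have h3 : v t = ((f t).2⁻¹ : Equiv.Perm ℕ) k := by
      rw [← h2, ← hv' t]
      simp
    have h4 := dirEval_not_eq_some.2 (hv t)
    rw [h3] at h4
    rcases h.cases _ _ _ h4 with h5 | ⟨-, h5, -⟩ | ⟨h5, h6, -⟩
    · have := hf1 (!(f t).1)
      rw [show ((((f t).2⁻¹ : 𝒢) : Equiv.Perm ℕ) k) = ((f t).2⁻¹ : Equiv.Perm ℕ) k from rfl] at this
      rw [this] at h5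
      cases h5
    · exact hf2 h5
    · have := hred t (inv_eq_one.1 (hf3 h6))
      rw [h1] at this
      simp at h5 this
      rw [h5] at this
      simp at this
  have hs : ∀ t, dirEval s (f t).1 (y t) = some (v t) := by
    intro t
    rcases h.cases _ _ _ (hv t) with h1 | h1 | h1
    · exact h1
    · exact absurd h1 (hfwd t)
    · -- shift by a period, so that there is a preceding move
      exfalso
      obtain ⟨L', hL'⟩ := Nat.exists_eq_add_of_lt hLpos
      have h2 : y (t + L' + 1) = y t := by rw [← hyper t]; congr 1; omega
      have h3 : f (t + L' + 1) = f t := by rw [← hper t]; congr 1; omega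
      have h4 : v (t + L' + 1) = v t := by
        have := hv (t + L' + 1)
        rw [h2, h3, hv t] at this
        simpa using this.symm
      exact hbwd (t + L') (by rw [h2, h3, h4]; exact h1)
  have hpos : ∀ t, pos s f y₀ t = some (y t) := by
    intro t
    induction t with
    | zero => rw [← hy 0]; rfl
    | succ t ih => rw [pos, ih]; exact move_eq_some.2 ⟨v t, hs t, hv' t⟩
  rw [mul_one, hpos, show y L = y₀ from
      Option.some.inj ((hy L).symm.trans (by simpa using hL 1)),
    show powList w.1 1 = w.1 by simp [powList], eq_comm, Option.map_eq_some_iff] at hback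
  obtain ⟨x', hx', hxx⟩ := hback
  rw [hy₀] at hxx
  rwa [(Equiv.injective _ hxx)] at hx'

theorem fixSet_finite {s : ℕ ≃. ℕ} (hs : {n : ℕ | s n ≠ none}.Finite) {w : Word 𝒢} (hX : w.HasX) :
    (fixSet (evalList s w.1)).Finite := by
  refine ((dirEval_finite hs (cycFun (cycMoves w.1) 0).1).preimage
    (initElt w.1 : Equiv.Perm ℕ).injective.injOn).subset fun x hx => ?_
  change evalList s w.1 x = some x at hx
  have h1 := pos_cycMoves_length s hX x
  rw [hx] at h1
  obtain ⟨y, hy⟩ := pos_isSome_of_le h1 (cycMoves_length_pos hX)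
  obtain ⟨k, hk, -⟩ := move_eq_some.1 (show move s (cycFun (cycMoves w.1) 0) _ = some y from hy)
  change dirEval s _ _ ≠ none
  rw [hk]
  simp

variable {𝒢 : Subgroup (Equiv.Perm ℕ)}

/-! ### Exact coding in terms of moves -/

namespace CodingWord

/-- The infinite sequence of moves along which a coding word is iterated. -/
def moves (w : CodingWord 𝒢) : ℕ → Bool × 𝒢 := cycFun (cycMoves w.1.1)

/-- The number of moves in one application of a coding word. -/
def len (w : CodingWord 𝒢) : ℕ := (cycMoves w.1.1).length

/-- The position of the parameter `m` after `t` moves of a coding word. -/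
def path (w : CodingWord 𝒢) (s : ℕ ≃. ℕ) (m t : ℕ) : Option ℕ :=
  pos s w.moves ((initElt w.1.1 : Equiv.Perm ℕ) m) t

theorem len_pos (w : CodingWord 𝒢) : 0 < w.len := cycMoves_length_pos w.2.2.2

theorem moves_add_of_dvd (w : CodingWord 𝒢) {T : ℕ} (hT : w.len ∣ T) (d : ℕ) :
    w.moves (T + d) = w.moves d := by
  obtain ⟨i, rfl⟩ := hT
  exact cycFun_length_mul_add _ i d

theorem isReducedSeq_moves (w : CodingWord 𝒢) : IsReducedSeq w.moves :=
  isReducedSeq_cycMoves w.2.2.2 w.2.1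

theorem path_len_mul (w : CodingWord 𝒢) (s : ℕ ≃. ℕ) (m i : ℕ) :
    w.path s m (w.len * i) =
      (evalList s (powList w.1.1 i) m).map (initElt w.1.1 : Equiv.Perm ℕ) :=
  pos_cycMoves s w.2.2.2 m i

theorem path_succ (w : CodingWord 𝒢) (s : ℕ ≃. ℕ) (m t : ℕ) :
    w.path s m (t + 1) = (w.path s m t).bind (move s (w.moves t)) := rfl

theorem path_mono (w : CodingWord 𝒢) {s s' : ℕ ≃. ℕ} (h : s ≤ s') {m t y : ℕ}
    (hy : w.path s m t = some y) : w.path s' m t = some y := pos_mono h _ hy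

theorem path_isSome_of_le (w : CodingWord 𝒢) {s : ℕ ≃. ℕ} {m t y : ℕ}
    (hy : w.path s m t = some y) {r : ℕ} (hr : r ≤ t) : ∃ u, w.path s m r = some u :=
  pos_isSome_of_le hy hr

theorem le_of_path_stuck (w : CodingWord 𝒢) {s : ℕ ≃. ℕ} {m t y : ℕ}
    (hy : w.path s m t = some y) (hn : dirEval s (w.moves t).1 y = none) {r x : ℕ}
    (hr : w.path s m r = some x) : r ≤ t := by
  by_contra hlt
  obtain ⟨u, hu⟩ := w.path_isSome_of_le hr (show t + 1 ≤ r by omega)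
  rw [path_succ, hy, Option.bind_some, move, hn] at hu
  cases hu

theorem path_mul_eq_some (w : CodingWord 𝒢) {s : ℕ ≃. ℕ} {m i v : ℕ} :
    evalList s (powList w.1.1 i) m = some v ↔
      w.path s m (w.len * i) = some ((initElt w.1.1 : Equiv.Perm ℕ) v) := by
  rw [path_len_mul]
  constructor
  · intro h
    rw [h]
    rfl
  · intro h
    obtain ⟨v', hv, hv'⟩ := Option.map_eq_some_iff.1 h
    rw [Equiv.injective _ hv'] at hv
    exact hv

end CodingWord

theorem evalList_of_no_X (s : ℕ ≃. ℕ) {u : List (Letter 𝒢)} (hu : ∀ j, Letter.X j ∉ u) (x : ℕ) :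
    evalList s u x = some ((initElt u : Equiv.Perm ℕ) x) := by
  rw [evalList_eq_foldr, syl_snd_eq_nil_iff.2 hu]
  rfl

/-- A word exactly codes some initial segment if and only if its path comes to an end after a
multiple of three rounds of moves, and all the values at multiples of three rounds are correct. -/
theorem exists_exactlyCodes_iff (w : CodingWord 𝒢) {s : ℕ ≃. ℕ} {x : ℕ → Fin 2} {m : ℕ} :
    (∃ l, ExactlyCodes w.1.1 s x l m) ↔
      (∃ k y, w.path s m (3 * w.len * k) = some y ∧ dirEval s (w.moves 0).1 y = none) ∧
      ∀ c y, w.path s m (3 * w.len * c) = some y →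
        ((initElt w.1.1)⁻¹ : Equiv.Perm ℕ) y ≡ (x c : ℕ) [MOD 2] := by
  have harith : ∀ c, 3 * w.len * c = w.len * (3 * c) := fun c => by ring
  have hblock : ∀ (t u : List (Letter 𝒢)) (i : Bool), w.1.1 = t ++ Letter.X i :: u →
      (∀ j, Letter.X j ∉ u) → ∀ k v, evalList s (powList w.1.1 (3 * k)) m = some v →
      evalList s (Letter.X i :: u ++ powList w.1.1 (3 * k)) m =
        dirEval s (w.moves 0).1 ((initElt w.1.1 : Equiv.Perm ℕ) v) := by
    intro t u i hw hu k v hv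
    rw [evalList_append, pequiv_trans_apply, hv, Option.bind_some]
    rw [evalList, pequiv_trans_apply, evalList_of_no_X s hu, Option.bind_some, Letter.eval_X,
      CodingWord.moves, hw, cycFun_zero_fst hu, initElt_append_X hu]
  have hend : ∀ k y, w.path s m (3 * w.len * k) = some y → dirEval s (w.moves 0).1 y = none →
      ∀ c y', w.path s m (3 * w.len * c) = some y' → c ≤ k := by
    intro k y hy hn c y' hy'
    have h1 := w.moves_add_of_dvd (T := 3 * w.len * k) ⟨3 * k, by ring⟩ 0
    rw [← h1, add_zero] at hn
    have := w.le_of_path_stuck hy hn hy'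
    have hpos := w.len_pos
    exact Nat.le_of_mul_le_mul_left this (by omega)
  constructor
  · rintro ⟨l, hcodes, k, rfl, t, u, i, hw, hu, hnone⟩
    obtain ⟨v, hv, -⟩ := hcodes k (by exact_mod_cast Nat.lt_succ_self k)
    have hp := (w.path_mul_eq_some).1 hv
    rw [← harith] at hp
    rw [hblock t u i hw hu k v hv] at hnone
    refine ⟨⟨k, _, hp, hnone⟩, fun c y hy => ?_⟩
    have hck := hend k _ hp hnone c y hy
    obtain ⟨v', hv', hpar⟩ := hcodes c (by exact_mod_cast Nat.lt_succ_of_le hck)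
    have hp' := (w.path_mul_eq_some).1 hv'
    rw [← harith, hy] at hp'
    obtain rfl : y = _ := Option.some.inj hp'
    simpa using hpar
  · rintro ⟨⟨k, y, hy, hn⟩, hpar⟩
    refine ⟨k + 1, fun c hc => ?_, k, rfl, ?_⟩
    · have hc : c < k + 1 := by exact_mod_cast hc
      obtain ⟨y', hy'⟩ := w.path_isSome_of_le hy
        (Nat.mul_le_mul_left (3 * w.len) (show c ≤ k by omega))
      refine ⟨((initElt w.1.1)⁻¹ : Equiv.Perm ℕ) y', ?_, hpar c y' hy'⟩
      rw [w.path_mul_eq_some, ← harith, hy']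
      simp
    · obtain ⟨t, u, i, hw, hu⟩ := exists_last_X w.2.2.2
      refine ⟨t, u, i, hw, hu, ?_⟩
      have hv : evalList s (powList w.1.1 (3 * k)) m =
          some (((initElt w.1.1)⁻¹ : Equiv.Perm ℕ) y) := by
        rw [w.path_mul_eq_some, ← harith, hy]
        simp
      rw [hblock t u i hw hu k _ hv]
      simpa using hn

/-! ### Extending the paths of the coding words -/

variable {z : CodingWord 𝒢 → ℕ → Fin 2}

/-- A finite partial injection `s` which extends that of the condition `p`, and satisfies all that
is required of a stronger condition, except that the path of a word `w` in the domain of `m` may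
have come to an end in the midst of a block of three rounds: it consists of the `T w` moves that it
had in `p`, and of `d w` further ones. Paths that wait for the same new pair have so far made the
same further moves. -/
structure IsPartialExt (p : CodingCond z) (T : CodingWord 𝒢 → ℕ) (s : ℕ ≃. ℕ)
    (d : CodingWord 𝒢 → ℕ) : Prop where
  finite : {n : ℕ | s n ≠ none}.Finite
  le : p.s ≤ s
  fix : ∀ w ∈ p.F, w.HasX → fixSet (evalList s w.1) = fixSet (evalList p.s w.1)
  dvd : ∀ w m, p.m w = some m → 3 * w.len ∣ T w
  stuck : ∀ w m, p.m w = some m → ∃ y, w.path s m (T w + d w) = some y ∧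
    dirEval s (w.moves (d w)).1 y = none
  parity : ∀ w m, p.m w = some m → ∀ c y, w.path s m (3 * w.len * c) = some y →
    ((initElt w.1.1)⁻¹ : Equiv.Perm ℕ) y ≡ (z w c : ℕ) [MOD 2]
  together : ∀ w m w' m', p.m w = some m → p.m w' = some m' → ∀ y,
    w.path s m (T w + d w) = some y → w'.path s m' (T w' + d w') = some y →
    (w.moves (d w)).1 = (w'.moves (d w')).1 → d w = d w' ∧ ∀ r < d w, w.moves r = w'.moves r

/-- The path of `w` waits for a new pair with source `n` in the direction `b`. -/
def IsWaiting (p : CodingCond z) (T : CodingWord 𝒢 → ℕ) (s : ℕ ≃. ℕ) (d : CodingWord 𝒢 → ℕ)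
    (b : Bool) (n : ℕ) (w : CodingWord 𝒢) : Prop :=
  ∃ m, p.m w = some m ∧ w.path s m (T w + d w) = some n ∧ (w.moves (d w)).1 = b

theorem exists_isPartialExt_self (p : CodingCond z) : ∃ T, IsPartialExt p T p.s fun _ => 0 := by
  have h1 : ∀ w, ∃ T, ∀ m, p.m w = some m → 3 * w.len ∣ T ∧ ∃ y, w.path p.s m T = some y ∧
      dirEval p.s (w.moves 0).1 y = none := by
    intro w
    rcases h : p.m w with _ | m
    · exact ⟨0, by simp⟩
    · obtain ⟨k, y, hy⟩ := ((exists_exactlyCodes_iff w).1 (p.exact_coding w m h)).1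
      refine ⟨3 * w.len * k, fun m' hm' => ?_⟩
      obtain rfl : m = m' := by simpa using hm'
      exact ⟨⟨k, rfl⟩, y, hy⟩
  choose T hT using h1
  exact ⟨T, p.s_finite, le_refl _, fun _ _ _ => rfl, fun w m h => (hT w m h).1,
    fun w m h => (hT w m h).2,
    fun w m h => ((exists_exactlyCodes_iff w).1 (p.exact_coding w m h)).2,
    fun _ _ _ _ _ _ _ _ _ _ => ⟨rfl, fun r hr => absurd hr (by omega)⟩⟩

theorem finite_range_cycFun (l : List (Bool × 𝒢)) : (Set.range (cycFun l)).Finite := by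
  refine ((List.finite_toSet l).union (Set.finite_singleton (true, 1))).subset ?_
  rintro _ ⟨j, rfl⟩
  rw [cycFun, List.getD_eq_getElem?_getD]
  rcases h : l[j % l.length]? with _ | x
  · simp
  · left
    exact List.mem_of_getElem? h

/-- A finite set of group elements that contains all those of the finitely many relevant words and
their inverses, as well as the quotients of any two of them. -/
theorem exists_finite_elts (p : CodingCond z) : ∃ A : Set 𝒢, A.Finite ∧ 1 ∈ A ∧
    (∀ w ∈ p.F, ∀ j, (cycFun (cycMoves w.1) j).2 ∈ A ∧ (cycFun (cycMoves w.1) j).2⁻¹ ∈ A) ∧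
    (∀ w, p.m w ≠ none → ∀ j, (w.moves j).2 ∈ A) ∧
    ∀ w w', p.m w ≠ none → p.m w' ≠ none → ∀ j j', (w.moves j).2⁻¹ * (w'.moves j').2 ∈ A := by
  let B : Set 𝒢 := (⋃ w ∈ p.F, Prod.snd '' Set.range (cycFun (cycMoves w.1))) ∪
    ⋃ w ∈ {w | p.m w ≠ none}, Prod.snd '' Set.range w.moves
  have hB : B.Finite := (p.F_finite.biUnion fun w _ => (finite_range_cycFun _).image _).union
    (p.m_finite.biUnion fun w _ => (finite_range_cycFun _).image _)
  have h1 : ∀ w ∈ p.F, ∀ j, (cycFun (cycMoves w.1) j).2 ∈ B := fun w hw j =>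
    Or.inl (Set.mem_biUnion hw ⟨_, ⟨j, rfl⟩, rfl⟩)
  have h2 : ∀ w, p.m w ≠ none → ∀ j, (w.moves j).2 ∈ B := fun w hw j =>
    Or.inr (Set.mem_biUnion (s := {w | p.m w ≠ none}) hw ⟨_, ⟨j, rfl⟩, rfl⟩)
  refine ⟨{1} ∪ B ∪ (fun g => g⁻¹) '' B ∪ Set.image2 (fun g h => g⁻¹ * h) B B,
    (((Set.finite_singleton 1).union hB).union (hB.image _)).union (hB.image2 _ hB),
    Or.inl (Or.inl (Or.inl rfl)), fun w hw j => ?_, fun w hw j => ?_, fun w w' hw hw' j j' => ?_⟩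
  · exact ⟨Or.inl (Or.inl (Or.inr (h1 w hw j))), Or.inl (Or.inr ⟨_, h1 w hw j, rfl⟩)⟩
  · exact Or.inl (Or.inl (Or.inr (h2 w hw j)))
  · exact Or.inr ⟨_, h2 w hw j, _, h2 w' hw' j', rfl⟩

/-- The hypothesis on parities for an arbitrary finite family of distinct group elements, which may
be empty. -/
theorem infinite_of_parity
    (hparity : ∀ (n : ℕ) (i : Fin (n + 1) → Fin 2) (g : Fin (n + 1) → Equiv.Perm ℕ),
      (∀ j, g j ∈ 𝒢) → Function.Injective g →
        {m : ℕ | ∀ j, g j m ≡ (i j : ℕ) [MOD 2]}.Infinite)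
    {ι : Type*} {R : Set ι} (hR : R.Finite) {g : ι → 𝒢} (hg : Set.InjOn g R) (i : ι → Fin 2) :
    {m : ℕ | ∀ j ∈ R, (g j : Equiv.Perm ℕ) m ≡ (i j : ℕ) [MOD 2]}.Infinite := by
  have := hR.fintype
  rcases hn : Fintype.card R with _ | n
  · have hempty : R = ∅ := by
      rw [Fintype.card_eq_zero_iff] at hn
      exact Set.isEmpty_coe_sort.1 hn
    simp [hempty, Set.infinite_univ]
  · let e := Fintype.equivFinOfCardEq hn
    refine (hparity n (fun k => i (e.symm k)) (fun k => g (e.symm k)) (fun k => (g _).2) ?_).mono ?_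
    · intro k k' h
      exact e.symm.injective (Subtype.ext (hg (e.symm k).2 (e.symm k').2 (Subtype.ext h)))
    · intro m hm j hj
      have := hm (e ⟨j, hj⟩)
      simpa using this

/-- If two waiting paths have made the same moves, and both complete a block of three rounds with
the next one, then their words impose conditions on the parities of the images of the new point
under distinct group elements. -/
theorem eq_of_block_end {w w' : CodingWord 𝒢} {d : ℕ} (hd : 3 * w.len ∣ d + 1)
    (hd' : 3 * w'.len ∣ d + 1) (h : ∀ r < d, w.moves r = w'.moves r)
    (hg : (initElt w.1.1)⁻¹ * (w.moves d).2 = (initElt w'.1.1)⁻¹ * (w'.moves d).2) : w = w' := by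
  obtain ⟨i, hi⟩ := hd
  obtain ⟨i', hi'⟩ := hd'
  -- `r` is a common period of both sequences of moves, and `r ≤ d`
  set r := w.len * i with hr
  have hr' : r = w'.len * i' := by
    have : 3 * (w.len * i) = 3 * (w'.len * i') := by rw [← mul_assoc, ← mul_assoc, ← hi, ← hi']
    omega
  have hrd : 3 * r = d + 1 := by rw [hr, hi, mul_assoc]
  have hf : w.moves = w'.moves := by
    funext j
    have h1 := w.moves_add_of_dvd (T := r * (j / r)) (Dvd.dvd.mul_right ⟨i, rfl⟩ _) (j % r)
    have h2 := w'.moves_add_of_dvd (T := r * (j / r)) (Dvd.dvd.mul_right ⟨i', hr'⟩ _) (j % r)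
    rw [Nat.div_add_mod] at h1 h2
    rw [h1, h2]
    have := Nat.mod_lt j (show 0 < r by omega)
    exact h _ (by omega)
  rw [hf, mul_left_inj, inv_inj] at hg
  exact CodingWord.eq_of_cycFun_eq hf hg

section Step

variable (h𝒢 : IsCofinitary 𝒢)
  (hparity : ∀ (n : ℕ) (i : Fin (n + 1) → Fin 2) (g : Fin (n + 1) → Equiv.Perm ℕ),
      (∀ j, g j ∈ 𝒢) → Function.Injective g →
        {m : ℕ | ∀ j, g j m ≡ (i j : ℕ) [MOD 2]}.Infinite)
include h𝒢 hparity

open Classical in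
/-- A new pair can be added with any source, and with a target outside any finite set: the paths
that wait for it make one further move, and the others remain as they are. -/
theorem IsPartialExt.exists_step {p : CodingCond z} {T : CodingWord 𝒢 → ℕ} {s : ℕ ≃. ℕ}
    {d : CodingWord 𝒢 → ℕ} (hs : IsPartialExt p T s d) {b : Bool} {n : ℕ}
    (hn : dirEval s b n = none) {E : Set ℕ} (hE : E.Finite) :
    ∃ s' k, k ∉ E ∧ IsEdgeExt s s' b n k ∧
      IsPartialExt p T s' fun w => if IsWaiting p T s d b n w then d w + 1 else d w := by
  obtain ⟨A, hA, hA1, hAF, hAm, hAq⟩ := exists_finite_elts p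
  -- the points where some path waits
  let Y : Set ℕ := {y | ∃ w m, p.m w = some m ∧ w.path s m (T w + d w) = some y}
  have hY : Y.Finite := by
    refine (p.m_graph_finite.image fun x => (x.1.path s x.2 (T x.1 + d x.1)).getD 0).subset ?_
    rintro y ⟨w, m, hm, hy⟩
    exact ⟨(w, m), hm, by simp [hy]⟩
  let R : Set (CodingWord 𝒢) := {w | IsWaiting p T s d b n w ∧ 3 * w.len ∣ d w + 1}
  have hR : R.Finite := p.m_finite.subset fun w hw => by
    obtain ⟨⟨m, hm, -⟩, -⟩ := hw
    change p.m w ≠ none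
    simp [hm]
  have hinj : Set.InjOn (fun w : CodingWord 𝒢 => (initElt w.1.1)⁻¹ * (w.moves (d w)).2) R := by
    rintro w ⟨⟨m, hm, hy, hb⟩, hw⟩ w' ⟨⟨m', hm', hy', hb'⟩, hw'⟩ h
    obtain ⟨h1, h2⟩ := hs.together w m w' m' hm hm' n hy hy' (hb.trans hb'.symm)
    simp only [← h1] at h hw'
    exact eq_of_block_end hw hw' h2 h
  have hfin : (E ∪ {k | ¬ IsFree A s n k} ∪ ⋃ g ∈ A, (g : Equiv.Perm ℕ) ⁻¹' Y).Finite :=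
    (hE.union (finite_not_isFree h𝒢 hA hs.finite n)).union
      (hA.biUnion fun g _ => hY.preimage (Equiv.injective _).injOn)
  obtain ⟨k, hkpar, hk⟩ := ((infinite_of_parity hparity hR hinj
    fun w => z w ((T w + d w + 1) / (3 * w.len))).sdiff hfin).nonempty
  simp only [Set.mem_union, Set.mem_ofPred_eq, Set.mem_iUnion, not_or, not_not,
    Set.mem_preimage, not_exists] at hk
  obtain ⟨⟨hkE, hkfree⟩, hkY⟩ := hk
  have hk0 : dirEval s (!b) k = none := by simpa using (hkfree 1 hA1).1 (!b)
  obtain ⟨s', hs'⟩ := exists_isEdgeExt hn hk0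
  -- the behaviour of the waiting paths
  have hwait : ∀ w m, p.m w = some m → w.path s m (T w + d w) = some n → (w.moves (d w)).1 = b →
      w.path s' m (T w + (d w + 1)) = some (((w.moves (d w)).2 : Equiv.Perm ℕ) k) ∧
      dirEval s' (w.moves (d w + 1)).1 (((w.moves (d w)).2 : Equiv.Perm ℕ) k) = none := by
    intro w m hm hy hb
    constructor
    · rw [← add_assoc, w.path_succ, w.path_mono hs'.le hy, Option.bind_some, move_eq_some,
        w.moves_add_of_dvd ((Dvd.intro_left _ rfl).trans (hs.dvd w m hm)), hb]
      exact ⟨k, hs'.eq_some, rfl⟩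
    · obtain ⟨h1, h2, h3⟩ := hkfree _ (hAm w (by simp [hm]) (d w))
      rw [Option.eq_none_iff_forall_ne_some]
      intro v hv
      rcases hs'.cases _ _ _ hv with h4 | ⟨-, h4, -⟩ | ⟨h4, h5, -⟩
      · rw [h1] at h4
        cases h4
      · exact h2 h4
      · have := w.isReducedSeq_moves (d w) (h3 h5)
        rw [h4, hb] at this
        simp at this
  -- the behaviour of the other paths
  have hstay : ∀ w m, p.m w = some m → ¬ IsWaiting p T s d b n w → ∀ y,
      w.path s m (T w + d w) = some y → dirEval s (w.moves (d w)).1 y = none →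
      dirEval s' (w.moves (d w)).1 y = none := by
    intro w m hm hnw y hy hnone
    rw [Option.eq_none_iff_forall_ne_some]
    intro v hv
    rcases hs'.cases _ _ _ hv with h4 | ⟨h4, rfl, -⟩ | ⟨-, rfl, -⟩
    · rw [hnone] at h4
      cases h4
    · exact hnw ⟨m, hm, hy, h4⟩
    · exact hkY 1 hA1 ⟨w, m, hm, by simpa using hy⟩
  refine ⟨s', k, hkE, hs', hs'.finite hs.finite, hs.le.trans hs'.le, fun w hw hX => ?_, hs.dvd,
    fun w m hm => ?_, fun w m hm c y hy => ?_, ?_⟩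
  · exact (fixSet_eq_of_isEdgeExt hs' hX (p.F_conj w hw) (hAF w hw) hkfree).trans (hs.fix w hw hX)
  · split_ifs with hw
    · obtain ⟨m', hm', hy, hb⟩ := hw
      obtain rfl : m = m' := by simpa [hm] using hm'
      exact ⟨_, hwait w m hm hy hb⟩
    · obtain ⟨y, hy, hnone⟩ := hs.stuck w m hm
      exact ⟨y, w.path_mono hs'.le hy, hstay w m hm hw y hy hnone⟩
  · obtain ⟨y₀, hy₀, hnone⟩ := hs.stuck w m hm
    by_cases hle : 3 * w.len * c ≤ T w + d w
    · obtain ⟨y', hy'⟩ := w.path_isSome_of_le hy₀ hle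
      have := w.path_mono hs'.le hy'
      rw [hy] at this
      obtain rfl : y = y' := Option.some.inj this
      exact hs.parity w m hm c y hy'
    · have hmoves := w.moves_add_of_dvd ((Dvd.intro_left 3 rfl).trans (hs.dvd w m hm))
      by_cases hw : IsWaiting p T s d b n w
      · obtain ⟨m', hm', hyn, hb⟩ := id hw
        obtain rfl : m = m' := by simpa [hm] using hm'
        obtain ⟨h1, h2⟩ := hwait w m hm hyn hb
        have h3 := w.le_of_path_stuck h1 (by rw [hmoves]; exact h2) hy
        have h4 : 3 * w.len * c = T w + d w + 1 := by omega
        rw [h4, add_assoc, h1] at hy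
        have h5 : 3 * w.len ∣ d w + 1 := by
          have h6 : 3 * w.len ∣ T w + (d w + 1) := ⟨c, by omega⟩
          exact (Nat.dvd_add_right (hs.dvd w m hm)).1 h6
        have h7 := hkpar w ⟨hw, h5⟩
        rw [← h4, Nat.mul_div_cancel_left _ (by have := w.len_pos; omega)] at h7
        obtain rfl := Option.some.inj hy
        exact h7
      · have h3 := w.le_of_path_stuck (w.path_mono hs'.le hy₀)
          (by rw [hmoves]; exact hstay w m hm hw y₀ hy₀ hnone) hy
        exact absurd h3 hle
  · intro w m w' m' hm hm' y hy hy' hb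
    have hval : ∀ w m, p.m w = some m → IsWaiting p T s d b n w →
        w.path s m (T w + d w) = some n ∧ (w.moves (d w)).1 = b := by
      rintro w m hm ⟨m₁, hm₁, h1, h2⟩
      obtain rfl : m = m₁ := by simpa [hm] using hm₁
      exact ⟨h1, h2⟩
    have hmix : ∀ w m w' m', p.m w = some m → p.m w' = some m' → IsWaiting p T s d b n w →
        w.path s' m (T w + (d w + 1)) = some y → w'.path s' m' (T w' + d w') = some y → False := by
      intro w m w' m' hm hm' hw hy hy'
      obtain ⟨h1, h2⟩ := hval w m hm hw
      rw [(hwait w m hm h1 h2).1] at hy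
      obtain rfl := Option.some.inj hy
      obtain ⟨y', hy'', -⟩ := hs.stuck w' m' hm'
      have := w'.path_mono hs'.le hy''
      rw [hy'] at this
      obtain rfl := Option.some.inj this
      exact hkY _ (hAm w (by simp [hm]) (d w)) ⟨w', m', hm', hy''⟩
    by_cases hw : IsWaiting p T s d b n w <;> by_cases hw' : IsWaiting p T s d b n w' <;>
      simp only [hw, hw', if_true, if_false] at hy hy' hb ⊢
    · obtain ⟨h1, h2⟩ := hval w m hm hw
      obtain ⟨h1', h2'⟩ := hval w' m' hm' hw'
      obtain ⟨h3, h4⟩ := hs.together w m w' m' hm hm' n h1 h1' (h2.trans h2'.symm)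
      refine ⟨by rw [h3], fun r hr => ?_⟩
      rcases Nat.lt_succ_iff_lt_or_eq.1 hr with hr | rfl
      · exact h4 r hr
      · rw [(hwait w m hm h1 h2).1] at hy
        rw [(hwait w' m' hm' h1' h2').1] at hy'
        have h5 := Option.some.inj (hy.trans hy'.symm)
        have h6 := (hkfree _ (hAq w w' (by simp [hm]) (by simp [hm']) (d w) (d w'))).2.2 (by
          change ((w.moves (d w)).2 : Equiv.Perm ℕ)⁻¹ (((w'.moves (d w')).2 : Equiv.Perm ℕ) k) = k
          rw [← h5]
          simp)
        rw [inv_mul_eq_one, ← h3] at h6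
        rw [← h3] at h2'
        exact Prod.ext (h2.trans h2'.symm) h6
    · exact (hmix w m w' m' hm hm' hw hy hy').elim
    · exact (hmix w' m' w m hm' hm hw' hy' hy).elim
    · obtain ⟨y₁, hy₁, -⟩ := hs.stuck w m hm
      obtain ⟨y₂, hy₂, -⟩ := hs.stuck w' m' hm'
      have e1 := w.path_mono hs'.le hy₁
      have e2 := w'.path_mono hs'.le hy₂
      rw [hy] at e1
      rw [hy'] at e2
      obtain rfl := Option.some.inj e1
      obtain rfl := Option.some.inj e2
      exact hs.together w m w' m' hm hm' _ hy₁ hy₂ hb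

/-- All paths can be led to the end of a block of three rounds: paths that have been set in motion
are extended up to a common multiple `N` of the lengths of the blocks. -/
theorem IsPartialExt.exists_completion {p : CodingCond z} {T : CodingWord 𝒢 → ℕ} (N : ℕ) :
    ∀ (μ : ℕ) (s : ℕ ≃. ℕ) (d : CodingWord 𝒢 → ℕ), IsPartialExt p T s d →
      (∀ w, p.m w ≠ none → d w ≤ N) → ∑ w ∈ p.m_finite.toFinset, (N - d w) = μ →
      ∃ s' d', s ≤ s' ∧ IsPartialExt p T s' d' ∧ ∀ w, p.m w ≠ none → d' w = 0 ∨ d' w = N := by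
  classical
  intro μ
  induction μ using Nat.strong_induction_on with
  | _ μ ih =>
    intro s d hs hdN hμ
    by_cases hdone : ∀ w, p.m w ≠ none → d w = 0 ∨ d w = N
    · exact ⟨s, d, le_refl _, hs, hdone⟩
    · push Not at hdone
      obtain ⟨w₀, hw₀, h0, hN⟩ := hdone
      have hlt : d w₀ < N := lt_of_le_of_ne (hdN w₀ hw₀) hN
      obtain ⟨m₀, hm₀⟩ := Option.ne_none_iff_exists'.1 hw₀
      obtain ⟨y₀, hy₀, hnone⟩ := hs.stuck w₀ m₀ hm₀
      obtain ⟨s', k, -, hs', hext⟩ := hs.exists_step h𝒢 hparity hnone Set.finite_empty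
      have hwaitlt : ∀ w, IsWaiting p T s d (w₀.moves (d w₀)).1 y₀ w → d w < N := by
        rintro w ⟨m, hm, hy, hb⟩
        rw [(hs.together w m w₀ m₀ hm hm₀ y₀ hy hy₀ hb).1]
        exact hlt
      have hlt' : ∑ w ∈ p.m_finite.toFinset, (N - if IsWaiting p T s d (w₀.moves (d w₀)).1 y₀ w
          then d w + 1 else d w) < μ := by
        rw [← hμ]
        refine Finset.sum_lt_sum (fun w _ => ?_) ⟨w₀, by simpa using hw₀, ?_⟩
        · split_ifs <;> omega
        · rw [if_pos ⟨m₀, hm₀, hy₀, rfl⟩]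
          omega
      obtain ⟨s'', d'', hle, hext', hd''⟩ := ih _ hlt' s' _ hext (fun w hw => by
        split_ifs with h
        · exact hwaitlt w h
        · exact hdN w hw) rfl
      exact ⟨s'', d'', hs'.le.trans hle, hext', hd''⟩

/-- Any point can be put into the domain (`b = true`) or the range (`b = false`) of the finite
injection of a condition, with a value outside any given finite set. -/
theorem CodingCond.exists_le_dirEval (p : CodingCond z) {b : Bool} {n : ℕ}
    (hn : dirEval p.s b n = none) {E : Set ℕ} (hE : E.Finite) :
    ∃ q ≤ p, ∃ k ∉ E, dirEval q.s b n = some k := by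
  classical
  obtain ⟨T, hT⟩ := exists_isPartialExt_self p
  obtain ⟨s, k, hkE, hs, hext⟩ := hT.exists_step h𝒢 hparity hn hE
  obtain ⟨N, hN0, hN⟩ : ∃ N, 0 < N ∧ ∀ w, p.m w ≠ none → 3 * w.len ∣ N := by
    refine ⟨∏ w ∈ p.m_finite.toFinset, 3 * w.len, Finset.prod_pos fun w _ => ?_, fun w hw => ?_⟩
    · have := w.len_pos
      omega
    · exact Finset.dvd_prod_of_mem (fun w : CodingWord 𝒢 => 3 * w.len) (by simpa using hw)
  obtain ⟨s', d', hle, hext', hd'⟩ := IsPartialExt.exists_completion h𝒢 hparity N _ s _ hext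
    (fun w _ => by split_ifs <;> omega) rfl
  refine ⟨⟨⟨s', p.F, hext'.finite, p.F_finite, p.F_conj⟩, p.m, p.m_finite, fun w m hm => ?_⟩,
    ⟨⟨hext'.le, subset_rfl, hext'.fix⟩, fun _ _ h => h⟩, k, hkE, ?_⟩
  · refine (exists_exactlyCodes_iff w).2 ⟨?_, hext'.parity w m hm⟩
    obtain ⟨y, hy, hnone⟩ := hext'.stuck w m hm
    have hdvd : 3 * w.len ∣ d' w := by
      rcases hd' w (by simp [hm]) with h | h
      · rw [h]
        exact dvd_zero _
      · rw [h]
        exact hN w (by simp [hm])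
    obtain ⟨i, hi⟩ := dvd_add (hext'.dvd w m hm) hdvd
    refine ⟨i, y, by rw [← hi]; exact hy, ?_⟩
    have := w.moves_add_of_dvd ((Dvd.intro_left 3 rfl).trans hdvd) 0
    rw [add_zero] at this
    rw [← this]
    exact hnone
  · exact dirEval_mono hle _ _ _ hs.eq_some

end Step

variable {𝒢 : Subgroup (Equiv.Perm ℕ)} {z : CodingWord 𝒢 → ℕ → Fin 2}

/-! ### Density -/

theorem CodingCond.exists_le_mem_F (p : CodingCond z) {w : Word 𝒢}
    (hw : ¬ w.HasProperConjSubword) : ∃ q ≤ p, w ∈ q.F := by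
  refine ⟨⟨⟨p.s, insert w p.F, p.s_finite, p.F_finite.insert w, ?_⟩, p.m, p.m_finite,
    p.exact_coding⟩, ⟨⟨le_refl _, Set.subset_insert _ _, fun _ _ _ => rfl⟩, fun _ _ h => h⟩,
    Set.mem_insert _ _⟩
  rintro v (rfl | hv)
  · exact hw
  · exact p.F_conj v hv

/-- A parameter of the right parity at which the path of `w` has no move at all can be added. -/
theorem CodingCond.exists_le_m_eq_some
    (hparity : ∀ (n : ℕ) (i : Fin (n + 1) → Fin 2) (g : Fin (n + 1) → Equiv.Perm ℕ),
      (∀ j, g j ∈ 𝒢) → Function.Injective g →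
        {m : ℕ | ∀ j, g j m ≡ (i j : ℕ) [MOD 2]}.Infinite)
    (p : CodingCond z) (w : CodingWord 𝒢) : ∃ q ≤ p, ∃ k, q.m w = some k := by
  classical
  rcases hpw : p.m w with _ | k
  swap
  · exact ⟨p, le_refl _, k, hpw⟩
  obtain ⟨m, hm1, hm2⟩ := ((infinite_of_parity hparity (Set.finite_singleton ())
    (g := fun _ => (1 : 𝒢)) (fun _ _ _ _ _ => rfl) fun _ => z w 0).sdiff
    ((dirEval_finite p.s_finite (w.moves 0).1).preimage
      (initElt w.1.1 : Equiv.Perm ℕ).injective.injOn)).nonempty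
  have hpar : m ≡ (z w 0 : ℕ) [MOD 2] := hm1 () rfl
  have hnone : dirEval p.s (w.moves 0).1 ((initElt w.1.1 : Equiv.Perm ℕ) m) = none := by
    by_contra h
    exact hm2 h
  refine ⟨⟨p.toZhangCond, Function.update p.m w (some m), ?_, ?_⟩, ⟨le_refl _, fun v k hv => ?_⟩, m,
    by simp⟩
  · refine (p.m_finite.insert w).subset fun v hv => ?_
    by_cases h : v = w
    · exact Or.inl h
    · right
      change Function.update p.m w (some m) v ≠ none at hv
      rwa [Function.update_of_ne h] at hv
  · intro v k hv
    by_cases h : v = w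
    · subst h
      obtain rfl : m = k := by simpa using hv
      refine (exists_exactlyCodes_iff v).2 ⟨⟨0, _, rfl, hnone⟩, fun c y hy => ?_⟩
      have h0 : 3 * v.len * c ≤ 0 :=
        v.le_of_path_stuck (show v.path p.s m 0 = some _ from rfl) hnone hy
      obtain rfl : c = 0 := by
        have := v.len_pos
        rcases Nat.eq_zero_or_pos c with h | h
        · exact h
        · have : 0 < 3 * v.len * c := by positivity
          omega
      obtain rfl : _ = y := Option.some.inj hy
      simpa using hpar
    · rw [Function.update_of_ne h] at hv
      exact p.exact_coding v k hv
  · have h : v ≠ w := by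
      rintro rfl
      simp [hpw] at hv
    change Function.update p.m w (some m) v = some k
    rw [Function.update_of_ne h, hv]

/-- If `τ` together with `𝒢` generates a cofinitary group and `τ ∉ 𝒢`, then the target of the pair
`(n, τ n)` is free for all but finitely many `n`. -/
theorem finite_not_isFree_apply (h𝒢 : IsCofinitary 𝒢) {τ : Equiv.Perm ℕ} (hτ : τ ∉ 𝒢)
    (hcof : IsCofinitary (Subgroup.closure ({τ} ∪ (𝒢 : Set (Equiv.Perm ℕ))))) {A : Set 𝒢}
    (hA : A.Finite) {s : ℕ ≃. ℕ} (hs : {n : ℕ | s n ≠ none}.Finite) :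
    {n | ¬ IsFree A s n (τ n)}.Finite := by
  have h1 : {n | ¬ IsFree A s n (τ n)} ⊆ τ ⁻¹' {k | ¬ IsFree A s 0 k} ∪
      ⋃ g ∈ A, {n | ((g : Equiv.Perm ℕ) * τ) n = n} := by
    intro n hn
    by_contra hcon
    simp only [Set.mem_union, Set.mem_preimage, Set.mem_ofPred_eq, Set.mem_iUnion, not_or,
      not_not, not_exists] at hcon
    exact hn fun g hg => ⟨(hcon.1 g hg).1, hcon.2 g hg, (hcon.1 g hg).2.2⟩
  refine (((finite_not_isFree h𝒢 hA hs 0).preimage τ.injective.injOn).union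
    (hA.biUnion fun g _ => ?_)).subset h1
  refine hcof _ (mul_mem (Subgroup.subset_closure (Or.inr g.2))
    (Subgroup.subset_closure (Or.inl rfl))) fun h => hτ ?_
  rw [← inv_eq_of_mul_eq_one_right h]
  exact inv_mem g.2

/-- The finite injection can be made to agree with `τ` at some point outside any finite set; the
paths of the coding words are not affected. -/
theorem CodingCond.exists_le_eq_apply (h𝒢 : IsCofinitary 𝒢) {τ : Equiv.Perm ℕ} (hτ : τ ∉ 𝒢)
    (hcof : IsCofinitary (Subgroup.closure ({τ} ∪ (𝒢 : Set (Equiv.Perm ℕ)))))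
    (p : CodingCond z) {E : Set ℕ} (hE : E.Finite) : ∃ q ≤ p, ∃ n ∉ E, q.s n = some (τ n) := by
  obtain ⟨A, hA, hA1, hAF, -, -⟩ := exists_finite_elts p
  obtain ⟨T, hT⟩ := exists_isPartialExt_self p
  -- the points where some path waits
  let Y : Set ℕ := {y | ∃ w m, p.m w = some m ∧ w.path p.s m (T w) = some y}
  have hY : Y.Finite := by
    refine (p.m_graph_finite.image fun x => (x.1.path p.s x.2 (T x.1)).getD 0).subset ?_
    rintro y ⟨w, m, hm, hy⟩
    exact ⟨(w, m), hm, by simp [hy]⟩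
  obtain ⟨n, hn⟩ := ((((hE.union p.s_finite).union
    (finite_not_isFree_apply h𝒢 hτ hcof hA p.s_finite)).union hY).union
    (hY.preimage τ.injective.injOn)).infinite_compl.nonempty
  simp only [Set.mem_compl_iff, Set.mem_union, Set.mem_preimage, not_or] at hn
  obtain ⟨⟨⟨⟨hnE, hns⟩, hfree⟩, hnY⟩, hτY⟩ := hn
  have hns : p.s n = none := by
    by_contra h
    exact hns h
  have hfree : IsFree A p.s n (τ n) := by
    by_contra h
    exact hfree h
  obtain ⟨s', hs'⟩ := exists_isEdgeExt (b := true) hns (by simpa using (hfree 1 hA1).1 false)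
  refine ⟨⟨⟨s', p.F, hs'.finite p.s_finite, p.F_finite, p.F_conj⟩, p.m, p.m_finite,
    fun w m hm => ?_⟩, ⟨⟨hs'.le, subset_rfl, fun w hw hX =>
      fixSet_eq_of_isEdgeExt hs' hX (p.F_conj w hw) (hAF w hw)
      hfree⟩, fun _ _ h => h⟩, n, hnE, hs'.eq_some⟩
  obtain ⟨y, hy, hnone⟩ := hT.stuck w m hm
  have hyY : y ∈ Y := ⟨w, m, hm, hy⟩
  have hnone' : dirEval s' (w.moves 0).1 y = none := by
    rw [Option.eq_none_iff_forall_ne_some]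
    intro v hv
    rcases hs'.cases _ _ _ hv with h4 | ⟨-, rfl, -⟩ | ⟨-, rfl, -⟩
    · rw [hnone] at h4
      cases h4
    · exact hnY hyY
    · exact hτY hyY
  obtain ⟨k, hk⟩ := hT.dvd w m hm
  rw [add_zero] at hy
  refine (exists_exactlyCodes_iff w).2 ⟨⟨k, y, by rw [← hk]; exact w.path_mono hs'.le hy, hnone'⟩,
    fun c y' hy' => ?_⟩
  have h1 := w.moves_add_of_dvd ((Dvd.intro_left 3 rfl).trans (hT.dvd w m hm)) 0
  rw [← h1] at hnone'
  have hle := w.le_of_path_stuck (w.path_mono hs'.le hy) hnone' hy'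
  obtain ⟨y'', hy''⟩ := w.path_isSome_of_le hy hle
  have := w.path_mono hs'.le hy''
  rw [hy'] at this
  obtain rfl := Option.some.inj this
  exact hT.parity w m hm c _ hy''

/-! ### Words evaluated at a permutation -/

/-- The homomorphism from the free product which maps `X` to `σ`. -/
def evalHom (𝒢 : Subgroup (Equiv.Perm ℕ)) (σ : Equiv.Perm ℕ) :
    Monoid.Coprod 𝒢 (FreeGroup Unit) →* Equiv.Perm ℕ :=
  Monoid.Coprod.lift 𝒢.subtype (FreeGroup.lift fun _ => σ)

theorem evalHom_letter_grp (σ : Equiv.Perm ℕ) (g : 𝒢) :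
    evalHom 𝒢 σ (Letter.grp g).val = (g : Equiv.Perm ℕ) := by
  simp [evalHom, Letter.val]

theorem evalHom_letter_X_true (σ : Equiv.Perm ℕ) :
    evalHom 𝒢 σ (Letter.X true : Letter 𝒢).val = σ := by
  simp [evalHom, Letter.val]

theorem evalHom_letter_X_false (σ : Equiv.Perm ℕ) :
    evalHom 𝒢 σ (Letter.X false : Letter 𝒢).val = σ⁻¹ := by
  simp [evalHom, Letter.val]

theorem evalList_toPEquiv (σ : Equiv.Perm ℕ) (l : List (Letter 𝒢)) (x : ℕ) :
    evalList σ.toPEquiv l x = some (evalHom 𝒢 σ (l.map Letter.val).prod x) := by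
  induction l with
  | nil => simp [evalList, PEquiv.refl_apply]
  | cons a l ih =>
    rw [evalList, pequiv_trans_apply, ih, Option.bind_some, List.map_cons, List.prod_cons, map_mul,
      Equiv.Perm.mul_apply]
    rcases a with g | _ | _
    · rw [evalHom_letter_grp]
      rfl
    · rw [evalHom_letter_X_false]
      rfl
    · rw [evalHom_letter_X_true]
      rfl

theorem prod_val_invList (l : List (Letter 𝒢)) :
    ((invList l).map Letter.val).prod = (l.map Letter.val).prod⁻¹ := by
  rw [List.prod_inv_reverse, invList, List.map_reverse, List.map_map, List.map_map]
  congr 3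
  funext a
  rcases a with g | _ | _ <;> simp [Letter.inv, Letter.val]

theorem exists_reduced_of_mem_closure {σ h : Equiv.Perm ℕ}
    (hh : h ∈ Subgroup.closure ((𝒢 : Set (Equiv.Perm ℕ)) ∪ {σ})) :
    ∃ w : List (Letter 𝒢), IsReducedWord w ∧ evalHom 𝒢 σ (w.map Letter.val).prod = h := by
  suffices H : ∃ l : List (Letter 𝒢), evalHom 𝒢 σ (l.map Letter.val).prod = h by
    obtain ⟨l, hl⟩ := H
    obtain ⟨w, hw, hwl⟩ := exists_reduced_val l
    exact ⟨w, hw, by rw [hwl, hl]⟩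
  induction hh using Subgroup.closure_induction with
  | mem x hx =>
    rcases hx with hx | rfl
    · exact ⟨[.grp ⟨x, hx⟩], by simpa using evalHom_letter_grp σ ⟨x, hx⟩⟩
    · exact ⟨[.X true], by simpa using evalHom_letter_X_true x⟩
  | one => exact ⟨[], by simp⟩
  | mul x y _ _ hx hy =>
    obtain ⟨l, rfl⟩ := hx
    obtain ⟨l', rfl⟩ := hy
    exact ⟨l ++ l', by simp⟩
  | inv x _ hx =>
    obtain ⟨l, rfl⟩ := hx
    exact ⟨invList l, by rw [prod_val_invList, map_inv]⟩

/-! ### The generic permutation -/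

section Generic

variable {G : Order.PFilter (CodingCond z)} {σ : Equiv.Perm ℕ}
  (hσ : ∀ n k : ℕ, σ n = k ↔ ∃ p ∈ G, p.s n = some k)
include hσ

/-- A value of a word at the generic permutation is decided by a finite part of it, hence by
arbitrarily strong conditions in the filter. -/
theorem exists_le_mem_filter_evalList (l : List (Letter 𝒢)) {x y : ℕ}
    (h : evalList σ.toPEquiv l x = some y) {p : CodingCond z} (hp : p ∈ G) :
    ∃ q ∈ G, q ≤ p ∧ evalList q.s l x = some y := by
  induction l generalizing y with
  | nil => exact ⟨p, hp, le_refl _, h⟩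
  | cons a l ih =>
    rw [evalList, pequiv_trans_apply, Option.bind_eq_some_iff] at h
    obtain ⟨v, hv, hy⟩ := h
    obtain ⟨q, hq, hqp, hqv⟩ := ih hv
    have key : ∃ r ∈ G, a.eval r.s v = some y := by
      rcases a with g | _ | _
      · exact ⟨q, hq, hy⟩
      · have h1 : σ y = v := ((Equiv.symm_apply_eq σ).1 (Option.some.inj hy)).symm
        obtain ⟨r, hr, h2⟩ := (hσ _ _).1 h1
        exact ⟨r, hr, (PEquiv.eq_some_iff r.s).2 h2⟩
      · exact (hσ _ _).1 (Option.some.inj hy)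
    obtain ⟨r, hr, hry⟩ := key
    obtain ⟨t, ht, htq, htr⟩ := G.directed q hq r hr
    have htq : t ≤ q := htq
    have htr : t ≤ r := htr
    refine ⟨t, ht, htq.trans hqp, ?_⟩
    rw [evalList, pequiv_trans_apply, evalList_mono htq.1.1 l _ _ hqv, Option.bind_some]
    rcases a with g | b
    · exact hry
    · rw [Letter.eval_X] at hry ⊢
      exact dirEval_mono htr.1.1 b _ _ hry

/-- Every word is evaluated at the generic permutation to a permutation which is the identity or has
only finitely many fixed points; conjugated subwords are removed one after the other. -/
theorem finite_fixedPoints_evalHom (h𝒢 : IsCofinitary 𝒢)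
    (hF : ∀ w : Word 𝒢, ¬ w.HasProperConjSubword → ∃ p ∈ G, w ∈ p.F) (n : ℕ) :
    ∀ w : Word 𝒢, w.1.length = n → evalHom 𝒢 σ w.val ≠ 1 →
      {x | evalHom 𝒢 σ w.val x = x}.Finite := by
  induction n using Nat.strong_induction_on with
  | _ n ih =>
    intro w hn hne
    by_cases hc : w.HasProperConjSubword
    · obtain ⟨v, u, hv, hw⟩ := hc
      have hu : IsReducedWord u := w.2.infix ⟨invList v, v, hw.symm⟩
      have hlen : u.length < n := by
        have : 0 < v.length := List.length_pos_of_ne_nil hv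
        rw [← hn, hw]
        simp
        omega
      have hval : evalHom 𝒢 σ w.val = (evalHom 𝒢 σ (v.map Letter.val).prod)⁻¹ *
          evalHom 𝒢 σ (Word.val ⟨u, hu⟩) * evalHom 𝒢 σ (v.map Letter.val).prod := by
        change evalHom 𝒢 σ (w.1.map Letter.val).prod = _ * evalHom 𝒢 σ (u.map Letter.val).prod * _
        rw [hw]
        simp [prod_val_invList, mul_assoc]
      rw [hval] at hne ⊢
      set V := evalHom 𝒢 σ (v.map Letter.val).prod
      have hne' : evalHom 𝒢 σ (Word.val ⟨u, hu⟩) ≠ 1 := by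
        intro h
        rw [h] at hne
        simp at hne
      refine ((ih _ hlen ⟨u, hu⟩ rfl hne').preimage V.injective.injOn).subset fun x hx => ?_
      change (V⁻¹ * _ * V) x = x at hx
      rw [Equiv.Perm.mul_apply, Equiv.Perm.mul_apply, Equiv.Perm.inv_eq_iff_eq] at hx
      exact hx
    · by_cases hX : w.HasX
      · obtain ⟨p, hp, hwp⟩ := hF w hc
        refine (fixSet_finite p.s_finite hX).subset fun x hx => ?_
        have hx' : evalList σ.toPEquiv w.1 x = some x := by
          rw [evalList_toPEquiv]
          exact congrArg some hx
        obtain ⟨q, -, hqp, hq⟩ := exists_le_mem_filter_evalList hσ w.1 hx' hp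
        rw [← hqp.1.2.2 w hwp hX]
        exact hq
      · have hX : ∀ j, Letter.X j ∉ w.1 := fun j hj => hX ⟨j, hj⟩
        rcases w.2.eq_of_no_X hX with ⟨h, -⟩ | ⟨h, -⟩
        · exact absurd (by rw [Word.val, h]; simp) hne
        · have hval : evalHom 𝒢 σ w.val = initElt w.1 := by
            rw [Word.val, h, List.map_singleton, List.prod_singleton, evalHom_letter_grp, ← h]
          rw [hval] at hne ⊢
          exact h𝒢 _ (initElt w.1).2 hne

theorem isCofinitary_closure_generic (h𝒢 : IsCofinitary 𝒢)
    (hF : ∀ w : Word 𝒢, ¬ w.HasProperConjSubword → ∃ p ∈ G, w ∈ p.F) :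
    IsCofinitary (Subgroup.closure ((𝒢 : Set (Equiv.Perm ℕ)) ∪ {σ})) := by
  intro h hh hne
  obtain ⟨w, hw, rfl⟩ := exists_reduced_of_mem_closure hh
  exact finite_fixedPoints_evalHom hσ h𝒢 hF _ ⟨w, hw⟩ rfl hne

/-- The finite injections of the conditions below `p` in the generic filter extend the path of a
word in the domain of `m` without bound, and its values have the right parities as the coding is
exact at each of these conditions. -/
theorem codes_generic {p : CodingCond z} (hp : p ∈ G) {w : CodingWord 𝒢} {m : ℕ}
    (hm : p.m w = some m) : Codes w.1.1 σ.toPEquiv (z w) ⊤ m := by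
  intro k _
  refine ⟨_, evalList_toPEquiv σ _ m, ?_⟩
  obtain ⟨q, -, hqp, hq⟩ := exists_le_mem_filter_evalList hσ (powList w.1.1 (3 * k))
    (evalList_toPEquiv σ _ m) hp
  have h1 := (w.path_mul_eq_some).1 hq
  have h2 := ((exists_exactlyCodes_iff w).1 (q.exact_coding w m (hqp.2 w m hm))).2 k _
    (by rw [← h1]; congr 1; ring)
  simpa using h2

end Generic

/-- The union of the finite injections in a filter is a permutation if every point lies in the
domain and in the range of one of them. -/
theorem exists_generic_perm {G : Order.PFilter (CodingCond z)}
    (hdom : ∀ n, ∃ p ∈ G, ∃ k, p.s n = some k) (hran : ∀ k, ∃ p ∈ G, ∃ n, p.s n = some k) :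
    ∃ σ : Equiv.Perm ℕ, ∀ n k : ℕ, σ n = k ↔ ∃ p ∈ G, p.s n = some k := by
  have hcommon : ∀ {p q : CodingCond z} {n n' k k' : ℕ}, p ∈ G → q ∈ G → p.s n = some k →
      q.s n' = some k' → ∃ r ∈ G, r.s n = some k ∧ r.s n' = some k' := by
    intro p q n n' k k' hp hq h h'
    obtain ⟨r, hr, hrp, hrq⟩ := G.directed p hp q hq
    have hrp : r ≤ p := hrp
    have hrq : r ≤ q := hrq
    exact ⟨r, hr, hrp.1.1 _ _ h, hrq.1.1 _ _ h'⟩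
  choose P hP F hF using hdom
  have hiff : ∀ n k, F n = k ↔ ∃ p ∈ G, p.s n = some k := by
    intro n k
    constructor
    · rintro rfl
      exact ⟨P n, hP n, hF n⟩
    · rintro ⟨p, hp, h⟩
      obtain ⟨r, -, h1, h2⟩ := hcommon hp (hP n) h (hF n)
      rw [h1] at h2
      exact (Option.some.inj h2).symm
  refine ⟨Equiv.ofBijective F ⟨fun n n' h => ?_, fun k => ?_⟩, hiff⟩
  · obtain ⟨r, -, h1, h2⟩ := hcommon (hP n) (hP n') (hF n) (hF n')
    exact r.s.inj h1 (h ▸ h2)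
  · obtain ⟨p, hp, n, h⟩ := hran k
    exact ⟨n, (hiff n k).2 ⟨p, hp, h⟩⟩

end ZhangCoding

open ZhangCoding
theorem mainTheorem4
    (M : Set ZFSet.{u}) (hM : IsTransitiveModelZFC M)
    (𝒢 : Subgroup (Equiv.Perm ℕ)) (h𝒢M : groupCode 𝒢 ∈ M)
    (h𝒢 : IsCofinitary 𝒢)
    (hparity : ∀ (n : ℕ) (i : Fin (n + 1) → Fin 2) (g : Fin (n + 1) → Equiv.Perm ℕ),
      (∀ j, g j ∈ 𝒢) → Function.Injective g →
        {m : ℕ | ∀ j, g j m ≡ (i j : ℕ) [MOD 2]}.Infinite)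
    (z : CodingWord 𝒢 → ℕ → Fin 2) (hzM : mapCode z ∈ M)
    (G : Order.PFilter (CodingCond z)) (hG : IsGeneric M G) :
    ∃ σ : Equiv.Perm ℕ,
      (∀ n k : ℕ, σ n = k ↔ ∃ p ∈ G, p.s n = some k) ∧
      IsCofinitary (Subgroup.closure ((𝒢 : Set (Equiv.Perm ℕ)) ∪ {σ})) ∧
      (∀ τ : Equiv.Perm ℕ, permCode τ ∈ M → τ ∉ 𝒢 →
        IsCofinitary (Subgroup.closure ({τ} ∪ (𝒢 : Set (Equiv.Perm ℕ)))) →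
          {n : ℕ | τ n = σ n}.Infinite ∧
          ¬ IsCofinitary (Subgroup.closure ((𝒢 : Set (Equiv.Perm ℕ)) ∪ {σ} ∪ {τ}))) ∧
      (∀ w : CodingWord 𝒢, ∃ m : ℕ, Codes w.1.1 σ.toPEquiv (z w) ⊤ m) := by
  have hext : ∀ (p : CodingCond z) (b : Bool) (n : ℕ), ∃ q ≤ p, ∃ k, dirEval q.s b n = some k := by
    intro p b n
    rcases h : dirEval p.s b n with _ | k
    · obtain ⟨q, hq, k, -, hk⟩ := p.exists_le_dirEval h𝒢 hparity h Set.finite_empty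
      exact ⟨q, hq, k, hk⟩
    · exact ⟨p, le_refl _, k, h⟩
  obtain ⟨σ, hσ⟩ := exists_generic_perm (G := G)
    (fun n => hG.exists_s_dom hM h𝒢M n fun p => hext p true n)
    (fun k => hG.exists_s_ran hM h𝒢M k fun p => by
      obtain ⟨q, hq, n, hn⟩ := hext p false k
      exact ⟨q, hq, n, (PEquiv.eq_some_iff q.s).1 hn⟩)
  refine ⟨σ, hσ, ?_, fun τ hτM hτ hcof => ?_, fun w => ?_⟩
  · exact isCofinitary_closure_generic hσ h𝒢 fun w hw =>
      hG.exists_mem_F hM h𝒢M w fun p => p.exists_le_mem_F hw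
  · have hinf : {n : ℕ | τ n = σ n}.Infinite := by
      intro hfin
      obtain ⟨p, hp, n, hn, h⟩ := hG.exists_s_eq_notMem hM h𝒢M hτM hfin fun p =>
        p.exists_le_eq_apply h𝒢 hτ hcof hfin
      exact hn ((hσ _ _).2 ⟨p, hp, h⟩).symm
    refine ⟨hinf, fun hcof' => hinf ?_⟩
    have hne : τ⁻¹ * σ ≠ 1 := by
      intro h
      obtain rfl : τ = σ := by
        rw [← inv_inv τ]
        exact inv_eq_of_mul_eq_one_right h
      obtain ⟨p, hp, n, k, hnk, hk⟩ := hG.exists_s_ne hM h𝒢M hτM fun p => by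
        obtain ⟨n, hn⟩ := p.s_finite.infinite_compl.nonempty
        have hn : dirEval p.s true n = none := by
          by_contra h
          exact hn h
        obtain ⟨q, hq, k, hk, hqk⟩ :=
          p.exists_le_dirEval h𝒢 hparity hn (Set.finite_singleton (τ n))
        exact ⟨q, hq, n, k, hqk, hk⟩
      exact hk ((hσ _ _).2 ⟨p, hp, hnk⟩).symm
    refine (hcof' (τ⁻¹ * σ) (mul_mem (inv_mem (Subgroup.subset_closure (Or.inr rfl)))
      (Subgroup.subset_closure (Or.inl (Or.inr rfl)))) hne).subset fun n hn => ?_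
    change (τ⁻¹ * σ) n = n
    rw [Equiv.Perm.mul_apply, Equiv.Perm.inv_eq_iff_eq]
    exact (show τ n = σ n from hn).symm
  · obtain ⟨p, hp, m, hm⟩ := hG.exists_m_eq_some hM h𝒢M w fun p => p.exists_le_m_eq_some hparity w
    exact ⟨m, codes_generic hσ hp hm⟩
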